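/- Let $\sqrt{\cdot}$ and $\log$ be the principal branches, and put $\sqrt[\downarrow]{z}=e^{i\pi/4}\sqrt{-iz}$, $\ \overset{\swarrow}{\log}(z)=\log(e^{-i\pi/4}z)+\tfrac{i\pi}{4}$ (branch cut $\Gamma=\{-te^{i\pi/4}:t\ge 0\}$), $\ \kappa(\mathfrak K,z)=\sqrt[\downarrow]{\mathfrak K-z}\,\sqrt[\downarrow]{\mathfrak K+z}$. Let $k>0$ and $$K(\alpha_1,\alpha_2)=\frac1{\kappa(\kappa(k,\alpha_2),\alpha_1)},\qquad K_{-\circ}(\alpha_1,\alpha_2)=\frac{1}{\sqrt[\downarrow]{\kappa(k,\alpha_2)-\alpha_1}},\qquad K_{+\circ}(\alpha_1,\alpha_2)=\frac{1}{\sqrt[\downarrow]{\kappa(k,\alpha_2)+\alpha_1}} .$$ For $j=1,2$ let $\mathcal A_j=\{x+i\varphi_j(x):x\in\mathbb R\}$, oriented from left to right, where $\varphi_j:\mathbb R\to\mathbb R$ is continuously differentiable with bounded derivative. Assume that $\mathcal A_j$ passes through $0$, above $-k$ and below $k$ (that is, $\varphi_j(0)=0$, $\varphi_j(-k)>0$,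 $\varphi_j(k)<0$), and that the contours avoid the branch cuts: $1\mp\alpha_1/\kappa(k,\alpha_2)\notin\Gamma$ for all $(\alpha_1,\alpha_2)\in\mathcal A_1\times\mathcal A_2$. Let $\mathrm{UHP}_j$ and $\mathrm{LHP}_j$ be the closed regions of points on or above, respectively on or below, $\mathcal A_j$, and set $\mathcal D_{++}=\mathrm{UHP}_1\times\mathrm{UHP}_2$, $\mathcal D_{+-}=\mathrm{UHP}_1\times\mathrm{LHP}_2$, $\mathcal D_{-+}=\mathrm{LHP}_1\times\mathrm{UHP}_2$, $\mathcal D_{--}=\mathrm{LHP}_1\times\mathrm{LHP}_2$. "Analytic on" a closed set means analytic in a neighbourhood of each of its points. For $\varepsilon>0$ let $\mathcal A^a_\varepsilon=\mathcal A_2+i\varepsilon$ and $\mathcal A^b_\varepsilon=\mathcal A_2-i\varepsilon$, and let $\mathcal S_\varepsilon$ be the closed strip between them. For $\alpha_1\in\mathrm{LHP}_1$ (upper sign) or $\alpha_1\in\mathrm{UHP}_1$ (lower sign) call $\varepsilon>0$ admissible if $z\mapsto\overset{\swarrow}{\log}(1\mp\alpha_1/\kappa(k,z))$ is analytic on $\mathcal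 S_\varepsilon$. Then: 1. $K=K_{-\circ}K_{+\circ}$ on $\mathcal A_1\times\mathcal A_2$, and for each $\alpha_2\in\mathcal A_2$ the function $K_{-\circ}(\cdot,\alpha_2)$ is analytic on $\mathrm{LHP}_1$ and $K_{+\circ}(\cdot,\alpha_2)$ is analytic on $\mathrm{UHP}_1$. 2. For every $R$ there is $\varepsilon_0>0$ such that, for both signs, every $\varepsilon\in(0,\varepsilon_0]$ is admissible for every corresponding $\alpha_1$ with $|\alpha_1|\le R$. 3. There are functions $K_{++},K_{+-},K_{-+},K_{--}$, analytic (jointly in $(\alpha_1,\alpha_2)$) on $\mathcal D_{++},\mathcal D_{+-},\mathcal D_{-+},\mathcal D_{--}$ respectively, such that $$K=K_{++}K_{+-}K_{-+}K_{--}\ \text{ on }\mathcal A_1\times\mathcal A_2,\quad K_{-\circ}=K_{-+}K_{--}\ \text{ on }\mathrm{LHP}_1\times\mathcal A_2,\quad K_{+\circ}=K_{++}K_{+-}\ \text{ on }\mathrm{UHP}_1\times\mathcal A_2 ,$$ and such that, with absolutely convergent integrals and for every admissible $\varepsilon$, $$K_{-+}(\alpha_1,\alpha_2)=\frac{1}{\sqrt[\downarrow]{\sqrt[\downarrow]{k+\alpha_2}}}\exp\Big\{\frac{-1}{4i\pi}\int_{\mathcal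 A^b_\varepsilon}\frac{\overset{\swarrow}{\log}\big(1-\frac{\alpha_1}{\kappa(k,z)}\big)}{z-\alpha_2}\,dz\Big\}\quad\text{on }\mathcal D_{-+},$$ $$K_{--}(\alpha_1,\alpha_2)=\frac{1}{\sqrt[\downarrow]{\sqrt[\downarrow]{k-\alpha_2}}}\exp\Big\{\frac{1}{4i\pi}\int_{\mathcal A^a_\varepsilon}\frac{\overset{\swarrow}{\log}\big(1-\frac{\alpha_1}{\kappa(k,z)}\big)}{z-\alpha_2}\,dz\Big\}\quad\text{on }\mathcal D_{--},$$ $$K_{++}(\alpha_1,\alpha_2)=\frac{1}{\sqrt[\downarrow]{\sqrt[\downarrow]{k+\alpha_2}}}\exp\Big\{\frac{-1}{4i\pi}\int_{\mathcal A^b_\varepsilon}\frac{\overset{\swarrow}{\log}\big(1+\frac{\alpha_1}{\kappa(k,z)}\big)}{z-\alpha_2}\,dz\Big\}\quad\text{on }\mathcal D_{++},$$ $$K_{+-}(\alpha_1,\alpha_2)=\frac{1}{\sqrt[\downarrow]{\sqrt[\downarrow]{k-\alpha_2}}}\exp\Big\{\frac{1}{4i\pi}\int_{\mathcal A^a_\varepsilon}\frac{\overset{\swarrow}{\log}\big(1+\frac{\alpha_1}{\kappa(k,z)}\big)}{z-\alpha_2}\,dz\Big\}\quad\text{on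 }\mathcal D_{+-}.$$ -/

import Mathlib

open Complex

/-- The square root `e^{iπ/4} √(-iz)` whose branch cut is the negative imaginary axis
(`√` being the principal square root). -/
noncomputable def downSqrt (z : ℂ) : ℂ :=
  exp (I * (Real.pi / 4 : ℝ)) * (-I * z) ^ (1 / 2 : ℂ)

/-- The logarithm `log (e^{-iπ/4} z) + iπ/4`, whose branch cut extends diagonally down and left
from the origin (`log` being the principal logarithm). -/
noncomputable def diagLog (z : ℂ) : ℂ :=
  log (exp (-(I * (Real.pi / 4 : ℝ))) * z) + I * (Real.pi / 4 : ℝ)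

/-- The branch cut of `diagLog` (branch point included). -/
def diagLogCut : Set ℂ :=
  {w | ∃ t : ℝ, 0 ≤ t ∧ w = -((t : ℂ) * exp (I * (Real.pi / 4 : ℝ)))}

/-- `κ(𝔎, z)`, a branch of `√(𝔎² - z²)`. -/
noncomputable def kappa (q z : ℂ) : ℂ := downSqrt (q - z) * downSqrt (q + z)

/-- The kernel `K(α₁, α₂) = 1 / κ(κ(k, α₂), α₁)`. -/
noncomputable def kernelK (k : ℝ) (α₁ α₂ : ℂ) : ℂ := 1 / kappa (kappa k α₂) α₁

/-- `K_{-∘}`. -/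
noncomputable def kernelMinus (k : ℝ) (α₁ α₂ : ℂ) : ℂ := 1 / downSqrt (kappa k α₂ - α₁)

/-- `K_{+∘}`. -/
noncomputable def kernelPlus (k : ℝ) (α₁ α₂ : ℂ) : ℂ := 1 / downSqrt (kappa k α₂ + α₁)

/-- A continuously differentiable contour running from `-∞` to `+∞`, parametrised by its real
part: `x ↦ x + i height(x)`, of bounded slope. -/
structure Contour where
  height : ℝ → ℝ
  contDiff : ContDiff ℝ 1 height
  slope_bounded : ∃ M : ℝ, ∀ x : ℝ, |deriv height x| ≤ M

namespace Contour

/-- The points of the contour. -/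
def carrier (A : Contour) : Set ℂ := {z | z.im = A.height z.re}

/-- The points on or above the contour. -/
def UHP (A : Contour) : Set ℂ := {z | A.height z.re ≤ z.im}

/-- The points on or below the contour. -/
def LHP (A : Contour) : Set ℂ := {z | z.im ≤ A.height z.re}

/-- The closed curved strip between the contours `A - iε` and `A + iε`. -/
def strip (A : Contour) (ε : ℝ) : Set ℂ := {z | |z.im - A.height z.re| ≤ ε}

/-- The contour passes through the origin, above `-k` and below `k`. -/
def IsIndented (A : Contour) (k : ℝ) : Prop :=
  A.height 0 = 0 ∧ 0 < A.height (-k) ∧ A.height k < 0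

/-- The pullback of `f(z) dz` to the real line by `x ↦ x + i (height(x) + c)`, which
parametrises the shifted contour `A + ic` from left to right. -/
noncomputable def pullback (A : Contour) (c : ℝ) (f : ℂ → ℂ) (x : ℝ) : ℂ :=
  f (x + ((A.height x + c : ℝ) : ℂ) * I) * (1 + ((deriv A.height x : ℝ) : ℂ) * I)

/-- `f(z) dz` is absolutely integrable over `A + ic`. -/
def IntegrableOver (A : Contour) (c : ℝ) (f : ℂ → ℂ) : Prop :=
  MeasureTheory.Integrable (A.pullback c f)

/-- The contour integral of `f(z) dz` over `A + ic`. -/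
noncomputable def integral (A : Contour) (c : ℝ) (f : ℂ → ℂ) : ℂ :=
  ∫ x : ℝ, A.pullback c f x

end Contour

/-! The splitting $K=K_{-\circ}K_{+\circ}$ is the definition of `kappa`. The content is the
splitting of each half in $\alpha_2$.

For $K_{-\circ}$, the root $\sqrt[\downarrow]{\kappa-\alpha_1}$ equals
$\sqrt[\downarrow]{\kappa}\,\exp\{\frac12\log(1-\alpha_1/\kappa)\}$, with $\log$ the diagonal branch
(`IsMinusRegion.downSqrt_kappa_sub`). Both sides have the same square, the right one does not
vanish, and they agree at $\alpha_1=0$ in the connected region below $\mathcal A_1$. The branches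
stay analytic there: the values of $\alpha_1$ that hit the log cut form a connected family which
avoids $\mathcal A_1$ by hypothesis and contains $k$, a point above $\mathcal A_1$
(`height_lt_kappa_ray`).

The first factor splits because nested downward roots are multiplicative (`downSqrt_downSqrt_mul`).
The logarithm splits additively by Cauchy's formula in the strip around $\mathcal A_2$
(`Contour.integral_sub_integral_eq`): the integral over the lower edge is analytic above that edge,
and the one over the upper edge below it. Since $\kappa(k,z)$ grows like $z$, the logarithm is
$O(1/z)$ and the integrals converge absolutely. Cauchy's theorem makes them independent of the
displacement, so locally constant choices of $\varepsilon$ glue to one function. Its joint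
analyticity comes from Osgood's lemma applied to dominated integrals.

The plus half is the minus half at $-\alpha_1$, with $\mathcal A_1$ rotated by a half-turn. -/

section

open Filter Topology Set MeasureTheory

/-! ### Branches of the square root, of `kappa` and of the logarithm -/

theorem exp_mul_I_quarter_sq : exp (I * (Real.pi / 4 : ℝ)) ^ 2 = I := by
  rw [← Complex.exp_nat_mul]
  have : ((2 : ℕ) : ℂ) * (I * (Real.pi / 4 : ℝ)) = (Real.pi / 2 : ℂ) * I := by
    push_cast; ring
  rw [this, Complex.exp_pi_div_two_mul_I]

theorem downSqrt_sq (z : ℂ) : downSqrt z ^ 2 = z := by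
  unfold downSqrt
  rw [mul_pow, exp_mul_I_quarter_sq]
  have : ((-I * z) ^ (1 / 2 : ℂ)) ^ 2 = -I * z := by
    simp
  rw [this]
  linear_combination (-z) * Complex.I_sq

theorem downSqrt_eq_zero {z : ℂ} : downSqrt z = 0 ↔ z = 0 := by
  constructor
  · intro h
    rw [← downSqrt_sq z, h]; simp
  · rintro rfl
    have := downSqrt_sq 0
    exact pow_eq_zero_iff two_ne_zero |>.1 this

theorem mem_slitPlane_neg_I_mul {z : ℂ} : -I * z ∈ slitPlane ↔ 0 < z.im ∨ z.re ≠ 0 := by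
  simp [Complex.mem_slitPlane_iff]

theorem analyticAt_downSqrt {z : ℂ} (hz : 0 < z.im ∨ z.re ≠ 0) : AnalyticAt ℂ downSqrt z := by
  unfold downSqrt
  refine analyticAt_const.mul (AnalyticAt.cpow (analyticAt_const.mul analyticAt_id)
    analyticAt_const ?_)
  exact mem_slitPlane_neg_I_mul.2 hz

/-- Every nonzero number has a logarithm on the sheet used by `downSqrt`. -/
theorem exists_exp_eq {z : ℂ} (hz : z ≠ 0) :
    ∃ u : ℂ, exp u = z ∧ -(Real.pi / 2) < u.im ∧ u.im ≤ 3 * Real.pi / 2 := by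
  refine ⟨log (-I * z) + (Real.pi / 2 : ℂ) * I, ?_, ?_, ?_⟩
  · rw [Complex.exp_add, Complex.exp_log (by simp [hz]), Complex.exp_pi_div_two_mul_I]
    linear_combination (-z) * Complex.I_sq
  · have h : ((Real.pi / 2 : ℂ) * I).im = Real.pi / 2 := by
      rw [show (Real.pi / 2 : ℂ) = ((Real.pi / 2 : ℝ) : ℂ) by push_cast; rfl]
      rw [Complex.im_ofReal_mul, Complex.I_im]; ring
    rw [Complex.add_im, h]
    linarith [Complex.neg_pi_lt_log_im (-I * z)]
  · have h : ((Real.pi / 2 : ℂ) * I).im = Real.pi / 2 := by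
      rw [show (Real.pi / 2 : ℂ) = ((Real.pi / 2 : ℝ) : ℂ) by push_cast; rfl]
      rw [Complex.im_ofReal_mul, Complex.I_im]; ring
    rw [Complex.add_im, h]
    linarith [Complex.log_im_le_pi (-I * z)]

/-- On the sheet of arguments $(-\pi/2,3\pi/2]$ the root halves the argument, so identities between
nested roots reduce to inequalities between arguments. -/
theorem downSqrt_exp {u : ℂ} (h₁ : -(Real.pi / 2) < u.im) (h₂ : u.im ≤ 3 * Real.pi / 2) :
    downSqrt (exp u) = exp (u / 2) := by
  have e : -I * exp u = exp (u - (Real.pi / 2 : ℂ) * I) := by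
    rw [Complex.exp_sub, Complex.exp_pi_div_two_mul_I]
    rw [Complex.div_I]; ring
  have h : ((Real.pi / 2 : ℂ) * I).im = Real.pi / 2 := by
    rw [show (Real.pi / 2 : ℂ) = ((Real.pi / 2 : ℝ) : ℂ) by push_cast; rfl]
    rw [Complex.im_ofReal_mul, Complex.I_im]; ring
  unfold downSqrt
  rw [e, Complex.cpow_def_of_ne_zero (Complex.exp_ne_zero _), Complex.log_exp, ← Complex.exp_add]
  · congr 1; push_cast; ring
  · rw [Complex.sub_im, h]; linarith
  · rw [Complex.sub_im, h]; linarith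

/-- The roots have arguments in $(-\pi/4,3\pi/4]$, so the sum of two such arguments stays on the
sheet $(-\pi/2,3\pi/2]$ and no sign is lost. -/
theorem downSqrt_downSqrt_mul (u v : ℂ) :
    downSqrt (downSqrt u * downSqrt v) = downSqrt (downSqrt u) * downSqrt (downSqrt v) := by
  by_cases hu : u = 0
  · simp [downSqrt_eq_zero.2 hu, downSqrt_eq_zero.2 rfl]
  by_cases hv : v = 0
  · simp [downSqrt_eq_zero.2 hv, downSqrt_eq_zero.2 rfl]
  obtain ⟨a, rfl, ha, ha'⟩ := exists_exp_eq hu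
  obtain ⟨b, rfl, hb, hb'⟩ := exists_exp_eq hv
  have hp := Real.pi_pos
  have ia : (a / 2).im = a.im / 2 := by simp
  have ib : (b / 2).im = b.im / 2 := by simp
  rw [downSqrt_exp ha ha', downSqrt_exp hb hb', ← Complex.exp_add, downSqrt_exp, downSqrt_exp,
    downSqrt_exp, ← Complex.exp_add]
  · congr 1; ring
  all_goals (try rw [Complex.add_im]); (try rw [ia]); (try rw [ib]); linarith

/-- The argument of a root lies in $(-\pi/4,3\pi/4]$, which excludes the negative imaginary axis. -/
theorem downSqrt_off_cut {z : ℂ} (hz : z ≠ 0) :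
    0 < (downSqrt z).im ∨ (downSqrt z).re ≠ 0 := by
  obtain ⟨a, rfl, ha, ha'⟩ := exists_exp_eq hz
  have hp := Real.pi_pos
  have ia : (a / 2).im = a.im / 2 := by simp
  rw [downSqrt_exp ha ha', Complex.exp_im, Complex.exp_re, ia]
  by_cases h : a.im ≤ 0
  · right
    have : 0 < Real.cos (a.im / 2) := Real.cos_pos_of_mem_Ioo ⟨by linarith, by linarith⟩
    positivity
  · left
    have : 0 < Real.sin (a.im / 2) := Real.sin_pos_of_pos_of_lt_pi (by linarith) (by linarith)
    positivity

theorem analyticAt_downSqrt_downSqrt {z : ℂ} (hz : 0 < z.im ∨ z.re ≠ 0) :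
    AnalyticAt ℂ (fun z => downSqrt (downSqrt z)) z := by
  refine AnalyticAt.fun_comp (analyticAt_downSqrt (downSqrt_off_cut ?_)) (analyticAt_downSqrt hz)
  rintro rfl
  simp at hz

theorem kappa_sq (q z : ℂ) : kappa q z ^ 2 = q ^ 2 - z ^ 2 := by
  unfold kappa
  rw [mul_pow, downSqrt_sq, downSqrt_sq]; ring

theorem downSqrt_kappa (q z : ℂ) :
    downSqrt (kappa q z) = downSqrt (downSqrt (q - z)) * downSqrt (downSqrt (q + z)) :=
  downSqrt_downSqrt_mul _ _

theorem analyticAt_kappa {q z : ℂ} (h₁ : 0 < (q - z).im ∨ (q - z).re ≠ 0)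
    (h₂ : 0 < (q + z).im ∨ (q + z).re ≠ 0) : AnalyticAt ℂ (kappa q) z := by
  unfold kappa
  exact (AnalyticAt.fun_comp (analyticAt_downSqrt h₁) (analyticAt_const.sub analyticAt_id)).mul
    (AnalyticAt.fun_comp (analyticAt_downSqrt h₂) (analyticAt_const.add analyticAt_id))

theorem kappa_ne_zero {q z : ℂ} (h₁ : 0 < (q - z).im ∨ (q - z).re ≠ 0)
    (h₂ : 0 < (q + z).im ∨ (q + z).re ≠ 0) : kappa q z ≠ 0 := by
  unfold kappa
  refine mul_ne_zero (fun h => ?_) (fun h => ?_)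
  · rw [downSqrt_eq_zero] at h; simp [h] at h₁
  · rw [downSqrt_eq_zero] at h; simp [h] at h₂

theorem analyticAt_diagLog {w : ℂ} (hw : exp (-(I * (Real.pi / 4 : ℝ))) * w ∈ slitPlane) :
    AnalyticAt ℂ diagLog w := by
  unfold diagLog
  exact ((analyticAt_const.mul analyticAt_id).clog hw).add analyticAt_const

theorem exp_diagLog {w : ℂ} (hw : w ≠ 0) : exp (diagLog w) = w := by
  unfold diagLog
  rw [Complex.exp_add, Complex.exp_log (mul_ne_zero (Complex.exp_ne_zero _) hw), mul_right_comm,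
    ← Complex.exp_add]
  simp

theorem diagLog_one : diagLog 1 = 0 := by
  unfold diagLog
  have hp := Real.pi_pos
  rw [mul_one, Complex.log_exp]
  · ring
  · rw [Complex.neg_im, Complex.mul_im]; simp; linarith
  · rw [Complex.neg_im, Complex.mul_im]; simp; linarith

theorem mem_slitPlane_of_notMem_diagLogCut {w : ℂ} (hw : w ∉ diagLogCut) :
    exp (-(I * (Real.pi / 4 : ℝ))) * w ∈ slitPlane := by
  by_contra h
  rw [Complex.mem_slitPlane_iff] at h
  push Not at h
  refine hw ⟨-(exp (-(I * (Real.pi / 4 : ℝ))) * w).re, by linarith [h.1], ?_⟩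
  have e : ((exp (-(I * (Real.pi / 4 : ℝ))) * w).re : ℂ) = exp (-(I * (Real.pi / 4 : ℝ))) * w :=
    Complex.ext (by simp) (by rw [h.2]; simp)
  rw [Complex.ofReal_neg, e, neg_mul, neg_neg, mul_right_comm, ← Complex.exp_add]
  simp

/-- `diagLog (1 - y) = O(y)` near `y = 0`. -/
theorem exists_norm_diagLog_one_sub_le :
    ∃ C > 0, ∃ r > 0, ∀ y : ℂ, ‖y‖ ≤ r → exp (-(I * (Real.pi / 4 : ℝ))) * (1 - y) ∈ slitPlane ∧
      ‖diagLog (1 - y)‖ ≤ C * ‖y‖ := by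
  have hs : exp (-(I * (Real.pi / 4 : ℝ))) * (1 - (0 : ℂ)) ∈ slitPlane := by
    have hp := Real.pi_pos
    left
    rw [sub_zero, mul_one, Complex.exp_re]
    have : 0 < Real.cos (-(I * (Real.pi / 4 : ℝ))).im := by
      apply Real.cos_pos_of_mem_Ioo
      rw [Complex.neg_im, Complex.mul_im]
      constructor <;> simp <;> linarith
    positivity
  have hd : DifferentiableAt ℂ (fun y : ℂ => diagLog (1 - y)) 0 :=
    (AnalyticAt.fun_comp (analyticAt_diagLog hs) (analyticAt_const.sub analyticAt_id)).differentiableAt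
  have hO := hd.isBigO_sub
  simp only [sub_zero, diagLog_one] at hO
  obtain ⟨C, hC, hO⟩ := hO.exists_pos
  rw [Asymptotics.isBigOWith_iff] at hO
  have hs' : ∀ᶠ y : ℂ in 𝓝 0, exp (-(I * (Real.pi / 4 : ℝ))) * (1 - y) ∈ slitPlane := by
    have hc : ContinuousAt (fun y : ℂ => exp (-(I * (Real.pi / 4 : ℝ))) * (1 - y)) 0 := by fun_prop
    exact hc.eventually_mem (isOpen_slitPlane.mem_nhds hs)
  obtain ⟨r, hr, h⟩ := Metric.nhds_basis_closedBall.eventually_iff.1 (hs'.and hO)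
  exact ⟨C, hC, r, hr, fun y hy => h (by simpa using hy)⟩

/-! ### Geometry of the contours -/

namespace Contour

/-- The point of `A + ic` with real part `x`. -/
noncomputable def point (A : Contour) (c x : ℝ) : ℂ := x + ((A.height x + c : ℝ) : ℂ) * I

@[simp] theorem point_re (A : Contour) (c x : ℝ) : (A.point c x).re = x := by simp [point]

@[simp] theorem point_im (A : Contour) (c x : ℝ) : (A.point c x).im = A.height x + c := by
  simp [point]

theorem continuous_height (A : Contour) : Continuous A.height := A.contDiff.continuous

theorem continuous_point (A : Contour) : Continuous fun p : ℝ × ℝ => A.point p.1 p.2 := by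
  unfold point
  have := A.continuous_height
  fun_prop

/-- Height above the contour and real part are global coordinates on the plane. -/
theorem eq_point (A : Contour) (z : ℂ) : z = A.point (z.im - A.height z.re) z.re := by
  apply Complex.ext <;> simp

theorem point_mem_carrier (A : Contour) (x : ℝ) : A.point 0 x ∈ A.carrier := by
  simp [carrier]

theorem zero_mem_carrier {A : Contour} {k : ℝ} (hA : A.IsIndented k) : (0 : ℂ) ∈ A.carrier := by
  simp [carrier, hA.1]

/-- The contour rotated by a half-turn about the origin. -/
noncomputable def neg (A : Contour) : Contour where
  height x := -A.height (-x)
  contDiff := (A.contDiff.comp contDiff_neg).neg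
  slope_bounded := by
    obtain ⟨M, hM⟩ := A.slope_bounded
    refine ⟨M, fun x => ?_⟩
    have h : deriv (fun x => -A.height (-x)) x = deriv A.height (-x) := by
      rw [deriv.fun_neg, deriv_comp_neg]; simp
    rw [h]; exact hM _

theorem mem_neg_carrier {A : Contour} {z : ℂ} : z ∈ A.neg.carrier ↔ -z ∈ A.carrier := by
  simp only [carrier, neg, mem_ofPred_eq, neg_im, neg_re]
  exact neg_eq_iff_eq_neg.symm

theorem mem_neg_LHP {A : Contour} {z : ℂ} : z ∈ A.neg.LHP ↔ -z ∈ A.UHP := by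
  simp only [LHP, UHP, neg, mem_ofPred_eq, neg_im, neg_re]
  exact le_neg

/-- A half-turn exchanges $k$ with $-k$ and above with below. -/
theorem IsIndented.neg {A : Contour} {k : ℝ} (hA : A.IsIndented k) : A.neg.IsIndented k := by
  obtain ⟨h0, h1, h2⟩ := hA
  refine ⟨?_, ?_, ?_⟩ <;> simp [Contour.neg, h0, h1, h2]

theorem isPreconnected_LHP (A : Contour) : IsPreconnected A.LHP := by
  -- The absolute value lets the whole plane, which is connected, parametrise the depths below the
  -- contour.
  have h : A.LHP = range fun p : ℝ × ℝ => A.point (-|p.1|) p.2 := by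
    ext z
    simp only [LHP, mem_ofPred_eq, mem_range, Prod.exists]
    constructor
    · intro hz
      refine ⟨z.im - A.height z.re, z.re, ?_⟩
      rw [abs_of_nonpos (by linarith), neg_neg, ← A.eq_point]
    · rintro ⟨s, x, rfl⟩
      simp
  rw [h]
  refine isPreconnected_range (A.continuous_point.comp (f := fun p : ℝ × ℝ => (-|p.1|, p.2)) ?_)
  fun_prop

theorem isClosed_LHP (A : Contour) : IsClosed A.LHP :=
  isClosed_le continuous_im (A.continuous_height.comp continuous_re)

/-- If $k-z$ lies on the cut, then $z$ is $k$ or vertically above it, hence strictly above the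
contour, which passes below $k$. -/
theorem off_cut_sub {A : Contour} {k : ℝ} (hA : A.IsIndented k) {z : ℂ} (hz : z ∈ A.LHP) :
    0 < ((k : ℂ) - z).im ∨ ((k : ℂ) - z).re ≠ 0 := by
  by_contra! h
  simp only [sub_im, ofReal_im, sub_re, ofReal_re] at h
  have hz' : z.im ≤ A.height z.re := hz
  rw [← sub_eq_zero.1 h.2] at hz'
  linarith [hA.2.2, h.1]

theorem off_cut_add {A : Contour} {k : ℝ} (hA : A.IsIndented k) {z : ℂ} (hz : z ∈ A.UHP) :
    0 < ((k : ℂ) + z).im ∨ ((k : ℂ) + z).re ≠ 0 := by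
  by_contra! h
  simp only [add_im, ofReal_im, add_re, ofReal_re] at h
  have hz' : A.height z.re ≤ z.im := hz
  rw [← neg_eq_of_add_eq_zero_right h.2] at hz'
  linarith [hA.2.1, h.1]

theorem carrier_subset_LHP (A : Contour) : A.carrier ⊆ A.LHP := fun _ hz => le_of_eq hz

theorem carrier_subset_UHP (A : Contour) : A.carrier ⊆ A.UHP := fun _ hz => ge_of_eq hz

end Contour

/-! ### The first split, in the $\alpha_1$-plane -/

/-- A connected region of `α₁`-values containing `0` on which `κ(k, z) - α₁` and
`1 - α₁ / κ(k, z)` avoid the branch cuts for every `z` on the contour. -/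
structure IsMinusRegion (k : ℝ) (A : Contour) (L : Set ℂ) : Prop where
  isClosed : IsClosed L
  isPreconnected : IsPreconnected L
  zero_mem : (0 : ℂ) ∈ L
  log_off_cut : ∀ a ∈ L, ∀ z ∈ A.carrier,
    exp (-(I * (Real.pi / 4 : ℝ))) * (1 - a / kappa k z) ∈ slitPlane
  sqrt_off_cut : ∀ a ∈ L, ∀ z ∈ A.carrier, 0 < (kappa k z - a).im ∨ (kappa k z - a).re ≠ 0

theorem kappa_zero_right (k : ℝ) : kappa k 0 = k := by
  unfold kappa
  rw [sub_zero, add_zero, ← pow_two, downSqrt_sq]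

/-- The points $\kappa(k,z)(1+te^{i\pi/4})$ are exactly the $\alpha_1$ for which
$1-\alpha_1/\kappa(k,z)$ hits the log cut. None lies on $\mathcal A_1$, and $\kappa(k,0)=k$ lies
above it; by the intermediate value theorem all do. -/
theorem height_lt_kappa_ray {k : ℝ} {A₁ A₂ : Contour}
    (hA₁ : A₁.IsIndented k) (hA₂ : A₂.IsIndented k)
    (hcut : ∀ α₁ ∈ A₁.carrier, ∀ α₂ ∈ A₂.carrier, 1 - α₁ / kappa k α₂ ∉ diagLogCut)
    {z : ℂ} (hz : z ∈ A₂.carrier) {t : ℝ} (ht : 0 ≤ t) :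
    A₁.height (kappa k z * (1 + t * exp (I * (Real.pi / 4 : ℝ)))).re <
      (kappa k z * (1 + t * exp (I * (Real.pi / 4 : ℝ)))).im := by
  have hne : ∀ z ∈ A₂.carrier, kappa k z ≠ 0 := fun z hz =>
    kappa_ne_zero (Contour.off_cut_sub hA₂ (A₂.carrier_subset_LHP hz))
      (Contour.off_cut_add hA₂ (A₂.carrier_subset_UHP hz))
  have hκ : Continuous fun x : ℝ => kappa k (A₂.point 0 x) := by
    refine continuous_iff_continuousAt.2 fun x => ?_
    have hx := A₂.point_mem_carrier x
    refine ContinuousAt.comp (f := fun x : ℝ => A₂.point 0 x)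
      (analyticAt_kappa (Contour.off_cut_sub hA₂ (A₂.carrier_subset_LHP hx))
        (Contour.off_cut_add hA₂ (A₂.carrier_subset_UHP hx))).continuousAt ?_
    exact (A₂.continuous_point.comp (by fun_prop : Continuous fun x : ℝ => ((0 : ℝ), x))).continuousAt
  -- Using $|p_2|$ for $t$ makes the parameter space all of $\mathbb R^2$.
  let w : ℝ × ℝ → ℂ := fun p =>
    kappa k (A₂.point 0 p.1) * (1 + (|p.2| : ℝ) * exp (I * (Real.pi / 4 : ℝ)))
  have hw : Continuous w := by
    have h1 : Continuous fun p : ℝ × ℝ => kappa k (A₂.point 0 p.1) := hκ.comp continuous_fst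
    have h2 : Continuous fun p : ℝ × ℝ => ((|p.2| : ℝ) : ℂ) :=
      continuous_ofReal.comp (continuous_abs.comp continuous_snd)
    exact h1.mul (continuous_const.add (h2.mul continuous_const))
  let φ : ℝ × ℝ → ℝ := fun p => (w p).im - A₁.height (w p).re
  have hφ : Continuous φ := by
    have := A₁.continuous_height
    fun_prop
  have hφ0 : 0 < φ (0, 0) := by
    have h0 : A₂.point 0 0 = 0 := by simp [Contour.point, hA₂.1]
    simp only [φ, w, h0, kappa_zero_right k]
    simpa using hA₁.2.2
  have key : 0 < φ (z.re, t) := by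
    by_contra! hneg
    obtain ⟨⟨x, s⟩, hp⟩ := mem_range_of_exists_le_of_exists_ge hφ ⟨_, hneg⟩ ⟨_, hφ0.le⟩
    have hx := A₂.point_mem_carrier x
    refine hcut (w (x, s)) (sub_eq_zero.1 hp) _ hx ⟨|s|, abs_nonneg s, ?_⟩
    have := hne _ hx
    simp only [w]
    rw [mul_div_cancel_left₀ _ this]
    ring
  have e : A₂.point 0 z.re = z := by
    rw [show (0 : ℝ) = z.im - A₂.height z.re from (sub_eq_zero.2 hz).symm, ← A₂.eq_point]
  simp only [φ, w, e, abs_of_nonneg ht] at key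
  linarith

theorem isMinusRegion_LHP {k : ℝ} {A₁ A₂ : Contour}
    (hA₁ : A₁.IsIndented k) (hA₂ : A₂.IsIndented k)
    (hcut : ∀ α₁ ∈ A₁.carrier, ∀ α₂ ∈ A₂.carrier, 1 - α₁ / kappa k α₂ ∉ diagLogCut) :
    IsMinusRegion k A₂ A₁.LHP where
  isClosed := A₁.isClosed_LHP
  isPreconnected := A₁.isPreconnected_LHP
  zero_mem := A₁.carrier_subset_LHP (Contour.zero_mem_carrier hA₁)
  log_off_cut a ha z hz := by
    refine mem_slitPlane_of_notMem_diagLogCut ?_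
    rintro ⟨t, ht, h⟩
    have hne : kappa k z ≠ 0 :=
      kappa_ne_zero (Contour.off_cut_sub hA₂ (A₂.carrier_subset_LHP hz))
        (Contour.off_cut_add hA₂ (A₂.carrier_subset_UHP hz))
    have e : a = kappa k z * (1 + t * exp (I * (Real.pi / 4 : ℝ))) := by
      have : a / kappa k z = 1 + t * exp (I * (Real.pi / 4 : ℝ)) := by linear_combination -h
      rw [← this, mul_div_cancel₀ _ hne]
    have := height_lt_kappa_ray hA₁ hA₂ hcut hz ht
    rw [← e] at this
    exact absurd ha (not_le.2 this)
  sqrt_off_cut a ha z hz := by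
    by_contra! h
    -- At $t=0$ the point $\kappa(k,z)$ itself is above $\mathcal A_1$, and so is every point
    -- vertically above it.
    have := height_lt_kappa_ray hA₁ hA₂ hcut hz le_rfl
    simp only [ofReal_zero, zero_mul, add_zero, mul_one] at this
    have ha' : a.im ≤ A₁.height a.re := ha
    rw [sub_im, sub_re] at h
    rw [← sub_eq_zero.1 h.2] at ha'
    linarith [h.1]

/-- Two continuous functions of $\alpha_1$ with equal squares, one of them nonvanishing, differ by a
constant sign on a connected set; the value at $\alpha_1=0$ fixes the sign. -/
theorem IsMinusRegion.downSqrt_kappa_sub {k : ℝ} {A : Contour} {L : Set ℂ}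
    (hA : A.IsIndented k) (hL : IsMinusRegion k A L) {a z : ℂ} (ha : a ∈ L) (hz : z ∈ A.carrier) :
    downSqrt (kappa k z - a) =
      downSqrt (kappa k z) * exp (diagLog (1 - a / kappa k z) / 2) := by
  have hne : kappa k z ≠ 0 :=
    kappa_ne_zero (Contour.off_cut_sub hA (A.carrier_subset_LHP hz))
      (Contour.off_cut_add hA (A.carrier_subset_UHP hz))
  refine hL.isPreconnected.eq_of_sq_eq (f := fun a => downSqrt (kappa k z - a))
    (g := fun a => downSqrt (kappa k z) * exp (diagLog (1 - a / kappa k z) / 2))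
    ?_ ?_ ?_ ?_ hL.zero_mem ?_ ha
  · intro b hb
    refine ContinuousAt.continuousWithinAt ?_
    exact ContinuousAt.comp (f := fun b => kappa k z - b)
      (analyticAt_downSqrt (hL.sqrt_off_cut b hb z hz)).continuousAt (by fun_prop)
  · intro b hb
    refine ContinuousAt.continuousWithinAt ?_
    have : ContinuousAt (fun b => diagLog (1 - b / kappa k z)) b :=
      ContinuousAt.comp (f := fun b => 1 - b / kappa k z)
        (analyticAt_diagLog (hL.log_off_cut b hb z hz)).continuousAt (by fun_prop)
    fun_prop
  · intro b hb
    have h1 : (1 - b / kappa k z) ≠ 0 := fun h => by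
      have := hL.log_off_cut b hb z hz
      rw [h, mul_zero] at this
      exact Complex.slitPlane_ne_zero this rfl
    simp only [Pi.pow_apply]
    rw [mul_pow, downSqrt_sq, downSqrt_sq, ← Complex.exp_nat_mul]
    rw [Nat.cast_ofNat, mul_div_cancel₀ _ (two_ne_zero), exp_diagLog h1]
    field_simp
  · intro b _
    exact mul_ne_zero (fun h => hne (downSqrt_eq_zero.1 h)) (Complex.exp_ne_zero _)
  · simp [diagLog_one]

theorem IsMinusRegion.analyticAt_kernelMinus {k : ℝ} {A : Contour} {L : Set ℂ}
    (hL : IsMinusRegion k A L) {a z : ℂ} (ha : a ∈ L) (hz : z ∈ A.carrier) :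
    AnalyticAt ℂ (fun a => kernelMinus k a z) a := by
  unfold kernelMinus
  have h := hL.sqrt_off_cut a ha z hz
  refine analyticAt_const.div (AnalyticAt.fun_comp (analyticAt_downSqrt h)
    (analyticAt_const.sub analyticAt_id)) ?_
  intro h0
  rw [downSqrt_eq_zero] at h0
  simp [h0] at h

/-! ### Cauchy's theorem between translates of a contour -/

namespace Contour

theorem continuous_deriv_height (A : Contour) : Continuous (deriv A.height) :=
  A.contDiff.continuous_deriv le_rfl

theorem pullback_eq (A : Contour) (c : ℝ) (f : ℂ → ℂ) (x : ℝ) :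
    A.pullback c f x = f (A.point c x) * (1 + ((deriv A.height x : ℝ) : ℂ) * I) := rfl

theorem continuous_pullback (A : Contour) {c : ℝ} {f : ℂ → ℂ}
    (hf : ∀ x, ContinuousAt f (A.point c x)) : Continuous (A.pullback c f) := by
  have h1 : Continuous fun x => f (A.point c x) := continuous_iff_continuousAt.2 fun x =>
    ContinuousAt.comp (f := fun x => A.point c x) (hf x)
      (A.continuous_point.comp (by fun_prop : Continuous fun x : ℝ => (c, x))).continuousAt
  have h2 := continuous_ofReal.comp A.continuous_deriv_height
  change Continuous fun x => f (A.point c x) * (1 + ((deriv A.height x : ℝ) : ℂ) * I)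
  exact h1.mul (continuous_const.add (h2.mul continuous_const))

theorem hasDerivAt_point (A : Contour) (c x : ℝ) :
    HasDerivAt (fun x => A.point c x) (1 + ((deriv A.height x : ℝ) : ℂ) * I) x := by
  have h : HasDerivAt A.height (deriv A.height x) x :=
    ((A.contDiff.differentiable one_ne_zero) x).hasDerivAt
  exact (Complex.ofRealCLM.hasDerivAt (x := x)).add (((h.add_const c).ofReal_comp).mul_const I)

theorem hasDerivAt_point_left (A : Contour) (c x : ℝ) :
    HasDerivAt (fun c => A.point c x) I c := by
  have h := (((hasDerivAt_id c).const_add (A.height x)).ofReal_comp).mul_const I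
  simpa [point] using h.const_add (x : ℂ)

/-- Cauchy's theorem for the region between two vertical translates of a contour and two vertical
segments. -/
theorem intervalIntegral_pullback_sub (A : Contour) {g : ℂ → ℂ} {c₁ c₂ : ℝ} (hc : c₁ ≤ c₂)
    (hg : AnalyticOnNhd ℂ g {z | c₁ ≤ z.im - A.height z.re ∧ z.im - A.height z.re ≤ c₂})
    (a b : ℝ) :
    (∫ x in a..b, A.pullback c₂ g x) - ∫ x in a..b, A.pullback c₁ g x =
      I * ∫ c in c₁..c₂, (g (A.point c b) - g (A.point c a)) := by
  set S := {z : ℂ | c₁ ≤ z.im - A.height z.re ∧ z.im - A.height z.re ≤ c₂} with hS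
  have hpt : ∀ c ∈ Icc c₁ c₂, ∀ x, A.point c x ∈ S := fun c hc x => by
    simp only [hS, mem_ofPred_eq, point_re, point_im, add_sub_cancel_left]
    exact hc
  have hu : uIcc c₁ c₂ = Icc c₁ c₂ := uIcc_of_le hc
  have hcont : ∀ c ∈ Icc c₁ c₂, Continuous (A.pullback c g) := fun c hc =>
    A.continuous_pullback fun x => (hg _ (hpt c hc x)).continuousAt
  have hd : ∀ c ∈ Icc c₁ c₂, ∀ x, HasDerivAt g (deriv g (A.point c x)) (A.point c x) :=
    fun c hc x => (hg _ (hpt c hc x)).differentiableAt.hasDerivAt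
  -- `F` is the $x$-derivative of $g$ along the translates, and `I * F` the $c$-derivative of the
  -- pullback. Both sides are therefore $I\iint F$ by Fubini, and the height is differentiated only
  -- once.
  let F : ℝ → ℝ → ℂ := fun c x =>
    deriv g (A.point c x) * (1 + ((deriv A.height x : ℝ) : ℂ) * I)
  have hF : ContinuousOn (Function.uncurry F) (Icc c₁ c₂ ×ˢ univ) := by
    intro p hp
    refine ContinuousAt.continuousWithinAt ?_
    have h1 : ContinuousAt (fun p : ℝ × ℝ => deriv g (A.point p.1 p.2)) p :=
      ContinuousAt.comp (f := fun p : ℝ × ℝ => A.point p.1 p.2)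
        (hg _ (hpt p.1 hp.1 p.2)).deriv.continuousAt A.continuous_point.continuousAt
    have h2 : ContinuousAt (fun p : ℝ × ℝ => (1 + ((deriv A.height p.2 : ℝ) : ℂ) * I)) p := by
      have := A.continuous_deriv_height
      fun_prop
    exact h1.mul h2
  have hFx : ∀ x, ContinuousOn (fun c => F c x) (uIcc c₁ c₂) := fun x => by
    rw [hu]
    exact hF.comp (f := fun c => (c, x)) (by fun_prop) fun c hc => ⟨hc, mem_univ _⟩
  have hFc : ∀ c ∈ Icc c₁ c₂, Continuous (F c) := fun c hc => by
    refine continuousOn_univ.1 ?_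
    exact hF.comp (f := fun x => (c, x)) (by fun_prop) fun x _ => ⟨hc, mem_univ _⟩
  have h1 : ∀ x, A.pullback c₂ g x - A.pullback c₁ g x = I * ∫ c in c₁..c₂, F c x := by
    intro x
    rw [← intervalIntegral.integral_const_mul]
    refine (intervalIntegral.integral_eq_sub_of_hasDerivAt (f := fun c => A.pullback c g x)
      (fun c hc => ?_) ?_).symm
    · rw [hu] at hc
      have := ((hd c hc x).comp c (A.hasDerivAt_point_left c x)).mul_const
        (1 + ((deriv A.height x : ℝ) : ℂ) * I)
      exact this.congr_deriv (by simp only [F]; ring)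
    · exact (continuousOn_const.mul (hFx x)).intervalIntegrable
  have h2 : ∀ c ∈ Icc c₁ c₂, g (A.point c b) - g (A.point c a) = ∫ x in a..b, F c x := by
    intro c hc
    refine (intervalIntegral.integral_eq_sub_of_hasDerivAt (f := fun x => g (A.point c x))
      (fun x _ => ?_) ?_).symm
    · exact (hd c hc x).comp x (A.hasDerivAt_point c x)
    · exact (hFc c hc).intervalIntegrable _ _
  rw [← intervalIntegral.integral_sub ((hcont c₂ ⟨hc, le_rfl⟩).intervalIntegrable _ _)
    ((hcont c₁ ⟨le_rfl, hc⟩).intervalIntegrable _ _)]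
  simp_rw [h1]
  rw [intervalIntegral.integral_const_mul, intervalIntegral_intervalIntegral_swap]
  · congr 1
    refine intervalIntegral.integral_congr fun c hc => ?_
    rw [hu] at hc
    exact (h2 c hc).symm
  · have h3 : ContinuousOn (Function.uncurry fun x c => F c x) (uIcc a b ×ˢ uIcc c₁ c₂) := by
      rw [hu]
      exact hF.comp (f := Prod.swap) continuous_swap.continuousOn fun p hp => ⟨hp.2, mem_univ _⟩
    exact (h3.integrableOn_compact (isCompact_uIcc.prod isCompact_uIcc)).mono_set
      (prod_mono uIoc_subset_uIcc uIoc_subset_uIcc)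

/-- If `g` is analytic between two translates of the contour and tends to zero there, the integrals
over the truncated translates have asymptotically vanishing difference. -/
theorem tendsto_intervalIntegral_pullback_sub (A : Contour) {g : ℂ → ℂ} {c₁ c₂ : ℝ} (hc : c₁ ≤ c₂)
    (hg : AnalyticOnNhd ℂ g {z | c₁ ≤ z.im - A.height z.re ∧ z.im - A.height z.re ≤ c₂})
    (hg0 : ∀ δ > 0, ∃ X : ℝ, ∀ c ∈ Icc c₁ c₂, ∀ x : ℝ, X ≤ |x| → ‖g (A.point c x)‖ ≤ δ) :
    Tendsto (fun X : ℝ => (∫ x in (-X)..X, A.pullback c₂ g x) - ∫ x in (-X)..X, A.pullback c₁ g x)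
      atTop (𝓝 0) := by
  simp_rw [A.intervalIntegral_pullback_sub hc hg]
  rw [Metric.tendsto_atTop]
  intro δ hδ
  -- The $+1$ covers $c_1=c_2$ and makes the final inequality strict.
  have hpos : 0 < 2 * (c₂ - c₁ + 1) := by linarith
  obtain ⟨X₀, hX₀⟩ := hg0 (δ / (2 * (c₂ - c₁ + 1))) (by positivity)
  refine ⟨X₀, fun X hX => ?_⟩
  rw [dist_zero_right, norm_mul, norm_I, one_mul]
  have hle : ∀ c ∈ uIoc c₁ c₂, ‖g (A.point c X) - g (A.point c (-X))‖ ≤ δ / (c₂ - c₁ + 1) := by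
    intro c hc'
    rw [uIoc_of_le hc] at hc'
    have hc'' : c ∈ Icc c₁ c₂ := ⟨hc'.1.le, hc'.2⟩
    calc _ ≤ ‖g (A.point c X)‖ + ‖g (A.point c (-X))‖ := norm_sub_le _ _
      _ ≤ δ / (2 * (c₂ - c₁ + 1)) + δ / (2 * (c₂ - c₁ + 1)) :=
        add_le_add (hX₀ c hc'' X (hX.le.trans (le_abs_self X)))
          (hX₀ c hc'' (-X) (hX.le.trans (by rw [abs_neg]; exact le_abs_self X)))
      _ = _ := by field_simp; ring
  refine (intervalIntegral.norm_integral_le_of_norm_le_const hle).trans_lt ?_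
  rw [abs_of_nonneg (by linarith), div_mul_eq_mul_div, div_lt_iff₀ (by linarith)]
  nlinarith

theorem integral_eq_of_analyticOnNhd (A : Contour) {g : ℂ → ℂ} {c₁ c₂ : ℝ} (hc : c₁ ≤ c₂)
    (hg : AnalyticOnNhd ℂ g {z | c₁ ≤ z.im - A.height z.re ∧ z.im - A.height z.re ≤ c₂})
    (hg0 : ∀ δ > 0, ∃ X : ℝ, ∀ c ∈ Icc c₁ c₂, ∀ x : ℝ, X ≤ |x| → ‖g (A.point c x)‖ ≤ δ)
    (h₁ : A.IntegrableOver c₁ g) (h₂ : A.IntegrableOver c₂ g) :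
    A.integral c₁ g = A.integral c₂ g := by
  have t := (intervalIntegral_tendsto_integral h₂ tendsto_neg_atTop_atBot tendsto_id).sub
    (intervalIntegral_tendsto_integral h₁ tendsto_neg_atTop_atBot tendsto_id)
  have := tendsto_nhds_unique t (A.tendsto_intervalIntegral_pullback_sub hc hg hg0)
  exact (sub_eq_zero.1 this).symm

end Contour

/-! ### Decay and integrability of the integrands -/

/-- From $|\kappa|^2=|k^2-z^2|\ge|z|^2-k^2\ge\frac34|z|^2$. -/
theorem half_norm_le_norm_kappa {k : ℝ} {z : ℂ} (hz : 2 * |k| ≤ ‖z‖) :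
    ‖z‖ / 2 ≤ ‖kappa k z‖ := by
  have h1 : ‖kappa k z‖ ^ 2 = ‖(k : ℂ) ^ 2 - z ^ 2‖ := by rw [← norm_pow, kappa_sq]
  have h2 : ‖z‖ ^ 2 - |k| ^ 2 ≤ ‖(k : ℂ) ^ 2 - z ^ 2‖ := by
    have := norm_sub_norm_le (z ^ 2) ((k : ℂ) ^ 2)
    rw [norm_sub_rev, norm_pow, norm_pow, norm_real, Real.norm_eq_abs] at this
    exact this
  have h3 := abs_nonneg k
  have h4 := norm_nonneg z
  refine (sq_le_sq₀ (by positivity) (norm_nonneg _)).1 ?_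
  rw [h1]
  nlinarith

/-- The logarithm in the factors decays like `1 / z`, uniformly for bounded `α₁`. -/
theorem exists_norm_diagLog_kappa_le (k R : ℝ) :
    ∃ C > 0, ∃ X > 0, ∀ a : ℂ, ‖a‖ ≤ R → ∀ z : ℂ, X ≤ ‖z‖ →
      exp (-(I * (Real.pi / 4 : ℝ))) * (1 - a / kappa k z) ∈ slitPlane ∧
      ‖diagLog (1 - a / kappa k z)‖ ≤ C / ‖z‖ := by
  obtain ⟨C, hC, r, hr, h⟩ := exists_norm_diagLog_one_sub_le
  refine ⟨C * (2 * (|R| + 1)), by positivity, 2 * |k| + 2 * (|R| + 1) / r, by positivity,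
    fun a ha z hz => ?_⟩
  have hz1 : 2 * |k| ≤ ‖z‖ := by
    have : 0 < 2 * (|R| + 1) / r := by positivity
    linarith
  have hz2 : 2 * (|R| + 1) / r ≤ ‖z‖ := by linarith [abs_nonneg k]
  have hz0 : 0 < ‖z‖ := lt_of_lt_of_le (by positivity) hz2
  have hκ := half_norm_le_norm_kappa hz1
  have hy : ‖a / kappa k z‖ ≤ 2 * (|R| + 1) / ‖z‖ := by
    rw [norm_div]
    calc ‖a‖ / ‖kappa k z‖ ≤ (|R| + 1) / (‖z‖ / 2) := by
          gcongr
          linarith [le_abs_self R]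
      _ = _ := by field_simp
  have hyr : 2 * (|R| + 1) / ‖z‖ ≤ r := by
    rw [div_le_iff₀ hz0]
    rw [div_le_iff₀ hr] at hz2
    linarith
  obtain ⟨h1, h2⟩ := h _ (hy.trans hyr)
  refine ⟨h1, h2.trans ?_⟩
  calc _ ≤ C * (2 * (|R| + 1) / ‖z‖) := by gcongr
    _ = _ := by ring

namespace Contour

theorem abs_le_norm_point (A : Contour) (c x : ℝ) : |x| ≤ ‖A.point c x‖ := by
  simpa using Complex.abs_re_le_norm (A.point c x)

theorem half_abs_le_norm_point_sub (A : Contour) {R : ℝ} {w : ℂ} (hw : ‖w‖ ≤ R) {x : ℝ}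
    (hx : 2 * R ≤ |x|) (c : ℝ) : |x| / 2 ≤ ‖A.point c x - w‖ := by
  have h := norm_sub_norm_le (A.point c x) w
  linarith [A.abs_le_norm_point c x]

theorem norm_tangent_le (A : Contour) :
    ∃ M ≥ 0, ∀ x, ‖1 + ((deriv A.height x : ℝ) : ℂ) * I‖ ≤ M := by
  obtain ⟨M, hM⟩ := A.slope_bounded
  refine ⟨1 + |M|, by positivity, fun x => (norm_add_le _ _).trans ?_⟩
  simp only [norm_one, norm_mul, norm_I, mul_one, norm_real, Real.norm_eq_abs]
  linarith [hM x, le_abs_self M]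

/-- The integrand of the factors. -/
noncomputable def logKernel (k : ℝ) (p : ℂ × ℂ) (z : ℂ) : ℂ :=
  diagLog (1 - p.1 / kappa k z) / (z - p.2)

/-- The logarithm and the Cauchy denominator each contribute a factor $1/|x|$, uniformly in the
displacement and in bounded parameters. -/
theorem exists_norm_logKernel_le (A : Contour) (k R : ℝ) :
    ∃ C > 0, ∃ X > 0, ∀ p : ℂ × ℂ, ‖p.1‖ ≤ R → ‖p.2‖ ≤ R → ∀ c x : ℝ, X ≤ |x| →
      ‖logKernel k p (A.point c x)‖ ≤ C * (1 + x ^ 2)⁻¹ := by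
  obtain ⟨C, hC, X, hX, h⟩ := exists_norm_diagLog_kappa_le k R
  refine ⟨4 * C, by positivity, X + 2 * |R| + 1, by positivity, fun p h1 h2 c x hx => ?_⟩
  have hR := abs_nonneg R
  have hx1 : 1 ≤ |x| := by linarith
  have hx0 : 0 < |x| := by linarith
  have e1 := (h p.1 h1 (A.point c x) ((by linarith : X ≤ |x|).trans (A.abs_le_norm_point c x))).2
  have e2 := A.half_abs_le_norm_point_sub (h2.trans (le_abs_self R))
    (by linarith : 2 * |R| ≤ |x|) c
  have e3 := A.abs_le_norm_point c x
  unfold logKernel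
  rw [norm_div]
  calc _ ≤ (C / |x|) / (|x| / 2) := by
        gcongr
        exact e1.trans (by gcongr)
    _ = 4 * C * (2 * x ^ 2)⁻¹ := by rw [← sq_abs x]; field_simp; norm_num
    _ ≤ 4 * C * (1 + x ^ 2)⁻¹ := by
        gcongr
        have : 1 ≤ |x| ^ 2 := by nlinarith
        rw [sq_abs] at this
        linarith

/-- Uniform integrable bound for the integrands with parameters in a compact set. -/
theorem exists_norm_pullback_le (A : Contour) (k c : ℝ) {S : Set (ℂ × ℂ)} (hS : IsCompact S)
    (hc : ContinuousOn (fun q : (ℂ × ℂ) × ℝ => A.pullback c (logKernel k q.1) q.2) (S ×ˢ univ)) :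
    ∃ C, ∀ p ∈ S, ∀ x, ‖A.pullback c (logKernel k p) x‖ ≤ C * (1 + x ^ 2)⁻¹ := by
  obtain ⟨R, hR⟩ := hS.isBounded.exists_norm_le
  obtain ⟨C, hC, X, hX, h⟩ := A.exists_norm_logKernel_le k R
  obtain ⟨M, hM, hM'⟩ := A.norm_tangent_le
  obtain ⟨C', hC'⟩ := (hS.prod (isCompact_Icc (a := -X) (b := X))).exists_bound_of_continuousOn
    (hc.mono (prod_mono_right (subset_univ _)))
  refine ⟨C * M + |C'| * (1 + X ^ 2), fun p hp x => ?_⟩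
  have hx2 : 0 < 1 + x ^ 2 := by positivity
  rcases le_or_gt X |x| with hx | hx
  · rw [pullback_eq, norm_mul]
    have hp1 : ‖p.1‖ ≤ R := (norm_fst_le p).trans (hR p hp)
    have hp2 : ‖p.2‖ ≤ R := (norm_snd_le p).trans (hR p hp)
    calc _ ≤ C * (1 + x ^ 2)⁻¹ * M := by
          gcongr
          · exact h p hp1 hp2 c x hx
          · exact hM' x
      _ = C * M * (1 + x ^ 2)⁻¹ := by ring
      _ ≤ _ := by
          gcongr
          have : 0 ≤ |C'| * (1 + X ^ 2) := by positivity
          linarith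
  · have h1 := hC' (p, x) ⟨hp, abs_le.1 hx.le⟩
    have h2 : x ^ 2 ≤ X ^ 2 := by
      rw [← sq_abs x]; exact pow_le_pow_left₀ (abs_nonneg x) hx.le 2
    calc _ ≤ |C'| := h1.trans (le_abs_self C')
      _ = |C'| * (1 + x ^ 2) * (1 + x ^ 2)⁻¹ := by field_simp
      _ ≤ _ := by
          gcongr
          have : 0 ≤ C * M := by positivity
          have : |C'| * (1 + x ^ 2) ≤ |C'| * (1 + X ^ 2) := by gcongr
          linarith

theorem integrableOver_logKernel (A : Contour) (k c : ℝ) (p : ℂ × ℂ)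
    (hc : ∀ x, ContinuousAt (logKernel k p) (A.point c x)) : A.IntegrableOver c (logKernel k p) := by
  have hcont := A.continuous_pullback hc
  obtain ⟨C, hC⟩ := A.exists_norm_pullback_le k c (isCompact_singleton (x := p)) (by
    refine (hcont.comp continuous_snd).continuousOn.congr ?_
    rintro ⟨q, x⟩ ⟨rfl, -⟩
    rfl)
  exact (integrable_inv_one_add_sq.const_mul C).mono' hcont.aestronglyMeasurable
    (Eventually.of_forall fun x => hC p rfl x)

/-! ### Cauchy's integral formula in a curved strip -/

/-- The residue is computed by an explicit primitive: the difference of the two integrands is, up to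
sign, the derivative of $\log m$ for the Möbius image $m=(\varepsilon+iw)/(\varepsilon-iw)$ of the
contour. This curve meets the real axis only at $m=1$ and tends to $-1$ from above at $+\infty$ and
from below at $-\infty$, so $\log m$ increases by $2\pi i$. -/
theorem tendsto_intervalIntegral_inv (A : Contour) {ε : ℝ} (hε : 0 < ε) (x₀ : ℝ) :
    Tendsto (fun X : ℝ =>
      (∫ x in (-X)..X, A.pullback ε (fun z => 1 / (z - A.point 0 x₀)) x) -
        ∫ x in (-X)..X, A.pullback (-ε) (fun z => 1 / (z - A.point 0 x₀)) x)
      atTop (𝓝 (-(2 * Real.pi * I))) := by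
  let w : ℝ → ℂ := fun x => A.point 0 x - A.point 0 x₀
  have hwre : ∀ x, (w x).re = x - x₀ := fun x => by simp [w]
  have hw : ∀ x, HasDerivAt w (1 + ((deriv A.height x : ℝ) : ℂ) * I) x := fun x =>
    (A.hasDerivAt_point 0 x).sub_const _
  have hwim : ∀ x, (w x).re = 0 → w x = 0 := fun x hx => by
    rw [hwre, sub_eq_zero] at hx
    simp [w, hx]
  have hpm : ∀ c x, A.point c x - A.point 0 x₀ = w x + c * I := fun c x => by
    simp only [w, point]; push_cast; ring
  have hne : ∀ δ : ℝ, δ ≠ 0 → ∀ x, w x + δ * I ≠ 0 := fun δ hδ x h => by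
    have h1 : (w x).re = 0 := by simpa using congrArg re h
    have h2 := hwim x h1
    rw [h2] at h
    simp [hδ] at h
  have hden : ∀ x, (ε : ℂ) - I * w x ≠ 0 := fun x h => hne ε hε.ne' x (by
    linear_combination I * h + (w x) * I_sq)
  let m : ℝ → ℂ := fun x => (ε + I * w x) / (ε - I * w x)
  have hm1 : ∀ x, m x = -1 + 2 * ε / (ε - I * w x) := fun x => by
    simp only [m]; field_simp [hden x]; ring
  have hmim : ∀ x, (m x).im = 2 * ε * (x - x₀) / normSq (ε - I * w x) := fun x => by
    rw [hm1, add_im, div_im, ← hwre]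
    simp
    ring
  have hslit : ∀ x, m x ∈ slitPlane := fun x => by
    by_cases hx : x = x₀
    · have : w x = 0 := by simp [w, hx]
      simp only [m, this, mul_zero, add_zero, sub_zero]
      rw [div_self (by exact_mod_cast hε.ne')]
      exact one_mem_slitPlane
    · right
      rw [hmim]
      have : normSq (ε - I * w x) ≠ 0 := normSq_eq_zero.not.2 (hden x)
      have : x - x₀ ≠ 0 := sub_ne_zero.2 hx
      positivity
  have hder : ∀ x, HasDerivAt (fun x => log (m x))
      (A.pullback (-ε) (fun z => 1 / (z - A.point 0 x₀)) x -
        A.pullback ε (fun z => 1 / (z - A.point 0 x₀)) x) x := fun x => by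
    have h1 := (((hw x).const_mul I).const_add (ε : ℂ)).div
      (((hw x).const_mul I).const_sub (ε : ℂ)) (hden x)
    refine (h1.clog_real (hslit x)).congr_deriv ?_
    rw [pullback_eq, pullback_eq, hpm, hpm]
    have a1 := hne ε hε.ne' x
    have a2 := hne (-ε) (neg_ne_zero.2 hε.ne') x
    have b1 : (ε : ℂ) - I * w x = -I * (w x + ε * I) := by linear_combination (ε : ℂ) * I_sq
    have b2 : (ε : ℂ) + I * w x = I * (w x + (-ε : ℝ) * I) := by
      push_cast; linear_combination (ε : ℂ) * I_sq
    simp only [Pi.div_apply]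
    rw [b1, b2]
    generalize w x + ε * I = a at a1 ⊢
    generalize w x + (-ε : ℝ) * I = b at a2 ⊢
    generalize 1 + ((deriv A.height x : ℝ) : ℂ) * I = T
    have e1 : I * T * (-I * a) - I * b * -(I * T) = T * (a - b) := by
      linear_combination (-(T * (a - b))) * I_sq
    have e2 : (-I * a) ^ 2 = -a ^ 2 := by linear_combination a ^ 2 * I_sq
    have e3 : I * b / (-I * a) = -(b / a) := by
      have hI := I_ne_zero
      field_simp
    rw [e1, e2, e3]
    field_simp
  have hcontp : ∀ δ : ℝ, δ ≠ 0 →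
      Continuous (A.pullback δ (fun z => 1 / (z - A.point 0 x₀))) := fun δ hδ =>
    A.continuous_pullback fun x => by
      have : A.point δ x - A.point 0 x₀ ≠ 0 := by rw [hpm]; exact hne δ hδ x
      fun_prop (disch := assumption)
  have hc1 := hcontp ε hε.ne'
  have hc2 := hcontp (-ε) (neg_ne_zero.2 hε.ne')
  have hint : ∀ X : ℝ, (∫ x in (-X)..X, A.pullback ε (fun z => 1 / (z - A.point 0 x₀)) x) -
      ∫ x in (-X)..X, A.pullback (-ε) (fun z => 1 / (z - A.point 0 x₀)) x =
      log (m (-X)) - log (m X) := fun X => by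
    rw [← neg_sub, ← intervalIntegral.integral_sub (hc2.intervalIntegrable _ _)
      (hc1.intervalIntegrable _ _), intervalIntegral.integral_eq_sub_of_hasDerivAt
      (fun x _ => hder x) ((hc2.sub hc1).intervalIntegrable _ _), neg_sub]
  simp_rw [hint]
  have hlim : ∀ l : Filter ℝ, Tendsto (fun x : ℝ => |x - x₀|) l atTop →
      Tendsto m l (𝓝 (-1)) := fun l hl => by
    have h1 : Tendsto (fun x => ‖(ε : ℂ) - I * w x‖) l atTop := by
      refine tendsto_atTop_mono (fun x => ?_) hl
      have := Complex.abs_im_le_norm ((ε : ℂ) - I * w x)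
      simpa [hwre, abs_sub_comm] using this
    have h2 : Tendsto (fun x => 2 * (ε : ℂ) / (ε - I * w x)) l (𝓝 0) := by
      rw [tendsto_zero_iff_norm_tendsto_zero]
      simp_rw [norm_div]
      exact h1.const_div_atTop _
    have := h2.const_add (-1)
    rw [add_zero] at this
    exact this.congr fun x => (hm1 x).symm
  have htop : Tendsto (fun x : ℝ => x - x₀) atTop atTop := tendsto_atTop_add_const_right _ _ tendsto_id
  have hbot : Tendsto (fun x : ℝ => x - x₀) atBot atBot := tendsto_atBot_add_const_right _ _ tendsto_id
  have l1 : Tendsto (fun x => log (m x)) atTop (𝓝 (Real.log ‖(-1 : ℂ)‖ + Real.pi * I)) := by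
    refine (tendsto_log_nhdsWithin_im_nonneg_of_re_neg_of_im_zero (by simp) (by simp)).comp
      (tendsto_nhdsWithin_iff.2 ⟨hlim _ (tendsto_abs_atTop_atTop.comp htop), ?_⟩)
    filter_upwards [eventually_ge_atTop x₀] with x hx
    rw [hmim]
    have : 0 ≤ x - x₀ := by linarith
    exact div_nonneg (by positivity) (normSq_nonneg _)
  have l2 : Tendsto (fun x => log (m x)) atBot (𝓝 (Real.log ‖(-1 : ℂ)‖ - Real.pi * I)) := by
    refine (tendsto_log_nhdsWithin_im_neg_of_re_neg_of_im_zero (by simp) (by simp)).comp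
      (tendsto_nhdsWithin_iff.2 ⟨hlim _ (tendsto_abs_atBot_atTop.comp hbot), ?_⟩)
    filter_upwards [eventually_lt_atBot x₀] with x hx
    rw [hmim]
    refine div_neg_of_neg_of_pos (by nlinarith) ?_
    exact normSq_pos.2 (hden x)
  have := (l2.comp tendsto_neg_atTop_atBot).sub l1
  rw [show (Real.log ‖(-1 : ℂ)‖ - Real.pi * I - (Real.log ‖(-1 : ℂ)‖ + Real.pi * I) : ℂ) =
    -(2 * Real.pi * I) by ring] at this
  exact this

/-- Cauchy's integral formula for a curved strip. -/
theorem integral_sub_integral_eq (A : Contour) {f : ℂ → ℂ} {ε : ℝ} (hε : 0 < ε)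
    (hf : AnalyticOnNhd ℂ f (A.strip ε)) {w : ℂ} (hw : w ∈ A.carrier)
    (hf0 : ∃ C X : ℝ, ∀ c x : ℝ, X ≤ |x| → ‖f (A.point c x)‖ ≤ C)
    (h₁ : A.IntegrableOver (-ε) fun z => f z / (z - w))
    (h₂ : A.IntegrableOver ε fun z => f z / (z - w)) :
    A.integral (-ε) (fun z => f z / (z - w)) - A.integral ε (fun z => f z / (z - w)) =
      2 * Real.pi * I * f w := by
  have hwx : w = A.point 0 w.re := by
    rw [show (0 : ℝ) = w.im - A.height w.re from (sub_eq_zero.2 hw).symm, ← A.eq_point]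
  have hwS : w ∈ A.strip ε := by
    simp only [strip, mem_ofPred_eq]
    rw [show w.im = A.height w.re from hw]; simpa using hε.le
  have hstrip : {z : ℂ | -ε ≤ z.im - A.height z.re ∧ z.im - A.height z.re ≤ ε} = A.strip ε := by
    ext z; simp only [strip, mem_ofPred_eq, abs_le]
  have hptS : ∀ c, |c| ≤ ε → ∀ x, A.point c x ∈ A.strip ε := fun c hc x => by
    simpa [strip] using hc
  -- Removing the pole: $f(z)/(z-w)$ is the difference quotient of $f$ at $w$, analytic across $w$,
  -- plus $f(w)/(z-w)$.
  have hg : AnalyticOnNhd ℂ (dslope f w) (A.strip ε) := by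
    intro z hz
    by_cases h : z = w
    · subst h
      obtain ⟨p, hp⟩ := hf z hz
      exact ⟨_, hp.has_fpower_series_dslope_fslope⟩
    · have h1 : AnalyticAt ℂ (fun z => (z - w)⁻¹ * (f z - f w)) z :=
        ((analyticAt_id.sub analyticAt_const).inv (sub_ne_zero.2 h)).mul
          ((hf z hz).sub analyticAt_const)
      refine h1.congr ?_
      filter_upwards [isOpen_ne.mem_nhds h] with y hy
      rw [dslope_of_ne _ hy, slope_def_field, div_eq_inv_mul]
  have hg0 : ∀ δ > 0, ∃ X : ℝ, ∀ c ∈ Icc (-ε) ε, ∀ x : ℝ, X ≤ |x| →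
      ‖dslope f w (A.point c x)‖ ≤ δ := by
    intro δ hδ
    obtain ⟨C, X, h⟩ := hf0
    refine ⟨|X| + 2 * ‖w‖ + 1 + 2 * (|C| + ‖f w‖) / δ, fun c _ x hx => ?_⟩
    have hpos : 0 ≤ 2 * (|C| + ‖f w‖) / δ := by positivity
    have hX := le_abs_self X
    have hX' := abs_nonneg X
    have hw0 := norm_nonneg w
    have e1 := h c x (by linarith)
    have e2 := A.half_abs_le_norm_point_sub (le_refl ‖w‖) (by linarith : 2 * ‖w‖ ≤ |x|) c
    have hx0 : 0 < |x| := by linarith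
    have hne : A.point c x ≠ w := fun h => by
      rw [h, sub_self, norm_zero] at e2; linarith
    rw [dslope_of_ne _ hne, slope_def_field, norm_div]
    calc _ ≤ (|C| + ‖f w‖) / (|x| / 2) := by
          gcongr
          exact (norm_sub_le _ _).trans (by linarith [le_abs_self C])
      _ ≤ δ := by
          rw [div_le_iff₀ (by positivity)]
          have : 2 * (|C| + ‖f w‖) / δ ≤ |x| := by linarith
          rw [div_le_iff₀ hδ] at this
          linarith
  have t1 := A.tendsto_intervalIntegral_pullback_sub (by linarith : -ε ≤ ε) (hstrip ▸ hg) hg0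
  have t2 := (A.tendsto_intervalIntegral_inv hε w.re).const_mul (f w)
  rw [← hwx] at t2
  have hoff : ∀ c : ℝ, c ≠ 0 → ∀ x, A.point c x ≠ w := fun c hc x h => by
    rw [← h] at hw
    have : A.height x + c = A.height x := by simpa [carrier] using hw
    exact hc (by linarith)
  -- Neither summand need be absolutely integrable on its own, so the splitting is made on truncated
  -- integrals.
  have hsplit : ∀ c : ℝ, c ≠ 0 → |c| ≤ ε → ∀ X : ℝ,
      (∫ x in (-X)..X, A.pullback c (fun z => f z / (z - w)) x) =
        (∫ x in (-X)..X, A.pullback c (dslope f w) x) +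
          f w * ∫ x in (-X)..X, A.pullback c (fun z => 1 / (z - w)) x := by
    intro c hc hcε X
    have i1 : Continuous (A.pullback c (dslope f w)) :=
      A.continuous_pullback fun x => (hg _ (hptS c hcε x)).continuousAt
    have i2 : Continuous (A.pullback c (fun z => 1 / (z - w))) :=
      A.continuous_pullback fun x => by
        have := sub_ne_zero.2 (hoff c hc x)
        fun_prop (disch := assumption)
    rw [← intervalIntegral.integral_const_mul, ← intervalIntegral.integral_add
      (i1.intervalIntegrable _ _) ((i2.intervalIntegrable _ _).const_mul _)]
    refine intervalIntegral.integral_congr fun x _ => ?_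
    simp only [pullback_eq]
    rw [dslope_of_ne _ (hoff c hc x), slope_def_field]
    ring
  have t3 := t1.add t2
  have t4 := (intervalIntegral_tendsto_integral h₂ tendsto_neg_atTop_atBot tendsto_id).sub
    (intervalIntegral_tendsto_integral h₁ tendsto_neg_atTop_atBot tendsto_id)
  have e := tendsto_nhds_unique t4 (t3.congr fun X => ?_)
  · change A.integral ε _ - A.integral (-ε) _ = _ at e
    rw [← neg_sub, e]
    ring
  · simp only [id]
    rw [hsplit ε hε.ne' (abs_of_pos hε).le, hsplit (-ε) (neg_ne_zero.2 hε.ne')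
      (by rw [abs_neg]; exact (abs_of_pos hε).le)]
    ring

end Contour

/-! ### Joint analyticity of integrals depending on two parameters -/

/-- The Cauchy kernel of a circle is, near the centre, an analytic function of the pole with values
in the bounded functions. -/
theorem exists_analyticAt_cauchyKernel {T : Type*} [TopologicalSpace T] (c : ℂ) {r : ℝ} (hr : 0 < r)
    (φ : T → ℝ) (hφ : Continuous φ) :
    ∃ U : ℂ → BoundedContinuousFunction T ℂ, AnalyticAt ℂ U c ∧
      ∀ᶠ a in 𝓝 c, ∀ t, U a t = (circleMap c r (φ t) - a)⁻¹ := by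
  let f : BoundedContinuousFunction T ℂ := BoundedContinuousFunction.ofNormedAddCommGroup
    (fun t => circleMap c r (φ t)) ((continuous_circleMap c r).comp hφ) (‖c‖ + r) fun t => by
      refine (norm_add_le _ _).trans ?_
      simp [abs_of_pos hr]
  let g : BoundedContinuousFunction T ℂ := BoundedContinuousFunction.ofNormedAddCommGroup
    (fun t => (circleMap c r (φ t) - c)⁻¹)
    ((((continuous_circleMap c r).comp hφ).sub continuous_const).inv₀ fun t => by
      simp [circleMap_ne_center hr.ne']) r⁻¹ fun t => by
      simp [abs_of_pos hr]
  let V : ℂ → BoundedContinuousFunction T ℂ := fun a => f - a • 1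
  have hV : AnalyticAt ℂ V c := analyticAt_const.sub (analyticAt_id.smul analyticAt_const)
  have hVt : ∀ a t, V a t = circleMap c r (φ t) - a := fun a t => by
    change circleMap c r (φ t) - a • (1 : ℂ) = _
    rw [smul_eq_mul, mul_one]
  have hfg : V c * g = 1 := by
    ext t
    have : circleMap c r (φ t) - c ≠ 0 := sub_ne_zero.2 (circleMap_ne_center hr.ne')
    change V c t * (circleMap c r (φ t) - c)⁻¹ = 1
    rw [hVt, mul_inv_cancel₀ this]
  have hu : IsUnit (V c) := IsUnit.of_mul_eq_one _ hfg
  -- `V` is affine in `a` with a unit as value at the centre, and inversion in a Banach algebra is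
  -- analytic at units.
  refine ⟨fun a => Ring.inverse (V a), ?_, ?_⟩
  · obtain ⟨u, hu'⟩ := hu
    have := analyticAt_inverse (𝕜 := ℂ) u
    rw [hu'] at this
    exact this.fun_comp hV
  · have : ∀ᶠ a in 𝓝 c, IsUnit (V a) := hV.continuousAt.eventually_mem (Units.isOpen.mem_nhds hu)
    filter_upwards [this] with a ha t
    have h := congrArg (fun f : BoundedContinuousFunction T ℂ => f t) (Ring.mul_inverse_cancel _ ha)
    simp only [BoundedContinuousFunction.coe_mul, Pi.mul_apply,
      BoundedContinuousFunction.coe_one, Pi.one_apply] at h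
    rw [hVt] at h
    exact eq_inv_of_mul_eq_one_right h

/-- **Osgood's lemma** in two variables: a continuous separately holomorphic function is jointly
analytic. -/
theorem analyticAt_of_separately_differentiableOn {F : ℂ × ℂ → ℂ} {p : ℂ × ℂ} {R : ℝ} (hR : 0 < R)
    (hc : ContinuousOn F (Metric.ball p.1 R ×ˢ Metric.ball p.2 R))
    (h₁ : ∀ b ∈ Metric.ball p.2 R, DifferentiableOn ℂ (fun a => F (a, b)) (Metric.ball p.1 R))
    (h₂ : ∀ a ∈ Metric.ball p.1 R, DifferentiableOn ℂ (fun b => F (a, b)) (Metric.ball p.2 R)) :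
    AnalyticAt ℂ F p := by
  set r := R / 2 with hr
  have hr0 : 0 < r := by positivity
  have hrR : r < R := by linarith
  have hsub : ∀ q : ℂ, Metric.closedBall q r ⊆ Metric.ball q R := fun q =>
    Metric.closedBall_subset_ball hrR
  have hcm : ∀ (q : ℂ) (θ : ℝ), circleMap q r θ ∈ Metric.closedBall q r := fun q θ =>
    circleMap_mem_closedBall q hr0.le θ
  obtain ⟨B, hB⟩ := ((isCompact_closedBall p.1 r).prod
    (isCompact_closedBall p.2 r)).exists_bound_of_continuousOn
      (hc.mono (prod_mono (hsub _) (hsub _)))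
  let d : ℂ → ℝ → ℂ := fun q θ => deriv (circleMap q r) θ
  have hd : ∀ q, Continuous (d q) := fun q => by
    simp only [d, deriv_circleMap]
    exact (continuous_circleMap 0 r).mul continuous_const
  have hdn : ∀ q θ, ‖d q θ‖ = r := fun q θ => by
    simp [d, deriv_circleMap, abs_of_pos hr0]
  have hFc : Continuous fun t : ℝ × ℝ => F (circleMap p.1 r t.1, circleMap p.2 r t.2) := by
    refine hc.comp_continuous ?_ fun t => ⟨hsub _ (hcm _ _), hsub _ (hcm _ _)⟩
    exact ((continuous_circleMap _ _).comp continuous_fst).prodMk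
      ((continuous_circleMap _ _).comp continuous_snd)
  let W : BoundedContinuousFunction (ℝ × ℝ) ℂ := BoundedContinuousFunction.ofNormedAddCommGroup
    (fun t => d p.1 t.1 * d p.2 t.2 * F (circleMap p.1 r t.1, circleMap p.2 r t.2))
    ((((hd _).comp continuous_fst).mul ((hd _).comp continuous_snd)).mul hFc) (r * r * B)
    fun t => by
      rw [norm_mul, norm_mul, hdn, hdn]
      gcongr
      exact hB _ ⟨hcm _ _, hcm _ _⟩
  let ν : Measure ℝ := volume.restrict (Ioc 0 (2 * Real.pi))
  -- The iterated Cauchy integral as a continuous linear functional of the product of the two Cauchy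
  -- kernels; composing it with their analytic dependence on the poles gives joint analyticity.
  let Λ : BoundedContinuousFunction (ℝ × ℝ) ℂ →L[ℂ] ℂ := LinearMap.mkContinuous
    { toFun := fun f => ∫ t, (W * f) t ∂(ν.prod ν)
      map_add' := fun f g => by
        rw [mul_add]
        exact integral_add ((W * f).integrable _) ((W * g).integrable _)
      map_smul' := fun s f => by
        rw [mul_smul_comm, RingHom.id_apply]
        exact integral_smul s _ }
    ((ν.prod ν).real univ * ‖W‖) fun f => by
      refine ((W * f).norm_integral_le_mul_norm (ν.prod ν)).trans ?_
      rw [mul_assoc]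
      gcongr
      exact norm_mul_le _ _
  obtain ⟨U₁, hU₁, e₁⟩ := exists_analyticAt_cauchyKernel p.1 hr0
    (fun t : ℝ × ℝ => t.1) continuous_fst
  obtain ⟨U₂, hU₂, e₂⟩ := exists_analyticAt_cauchyKernel p.2 hr0
    (fun t : ℝ × ℝ => t.2) continuous_snd
  have hmain : AnalyticAt ℂ (fun q : ℂ × ℂ => ((2 * Real.pi * I)⁻¹ * (2 * Real.pi * I)⁻¹) *
      Λ (U₁ q.1 * U₂ q.2)) p := by
    refine analyticAt_const.mul ((Λ.analyticAt _).fun_comp ?_)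
    exact (hU₁.fun_comp analyticAt_fst).mul (hU₂.fun_comp analyticAt_snd)
  refine hmain.congr ?_
  have e₁' := (continuous_fst.tendsto p).eventually e₁
  have e₂' := (continuous_snd.tendsto p).eventually e₂
  have b₁ := (continuous_fst.tendsto p).eventually (Metric.ball_mem_nhds p.1 hr0)
  have b₂ := (continuous_snd.tendsto p).eventually (Metric.ball_mem_nhds p.2 hr0)
  filter_upwards [e₁', e₂', b₁, b₂] with q he₁ he₂ hb₁ hb₂
  have hpi : (2 * Real.pi * I : ℂ) ≠ 0 := two_pi_I_ne_zero
  have c₁ : ∀ b ∈ Metric.ball p.2 R, ∀ a ∈ Metric.ball p.1 r,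
      ∫ θ in (0)..2 * Real.pi, d p.1 θ * ((circleMap p.1 r θ - a)⁻¹ * F (circleMap p.1 r θ, b)) =
        2 * Real.pi * I * F (a, b) := fun b hb a ha => by
    have := DiffContOnCl.circleIntegral_sub_inv_smul (f := fun a => F (a, b)) (c := p.1) (R := r)
      (DifferentiableOn.diffContOnCl (by
        rw [closure_ball _ hr0.ne']; exact (h₁ b hb).mono (hsub _))) ha
    simpa only [circleIntegral, smul_eq_mul] using this
  have c₂ : ∀ a ∈ Metric.ball p.1 R, ∀ b ∈ Metric.ball p.2 r,
      ∫ θ in (0)..2 * Real.pi, d p.2 θ * ((circleMap p.2 r θ - b)⁻¹ * F (a, circleMap p.2 r θ)) =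
        2 * Real.pi * I * F (a, b) := fun a ha b hb => by
    have := DiffContOnCl.circleIntegral_sub_inv_smul (f := fun b => F (a, b)) (c := p.2) (R := r)
      (DifferentiableOn.diffContOnCl (by
        rw [closure_ball _ hr0.ne']; exact (h₂ a ha).mono (hsub _))) hb
    simpa only [circleIntegral, smul_eq_mul] using this
  have hΛ : Λ (U₁ q.1 * U₂ q.2) = 2 * Real.pi * I * (2 * Real.pi * I * F q) := by
    change ∫ t, (W * (U₁ q.1 * U₂ q.2)) t ∂(ν.prod ν) = _
    rw [integral_prod _ ((W * (U₁ q.1 * U₂ q.2)).integrable _)]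
    rw [← c₁ q.2 (Metric.ball_subset_ball hrR.le hb₂) q.1 hb₁,
      ← intervalIntegral.integral_const_mul,
      intervalIntegral.integral_of_le Real.two_pi_pos.le]
    refine integral_congr_ae (Eventually.of_forall fun θ => ?_)
    beta_reduce
    have := c₂ (circleMap p.1 r θ) (hsub _ (hcm _ _)) q.2 hb₂
    rw [show (2 * Real.pi * I : ℂ) * (d p.1 θ * ((circleMap p.1 r θ - q.1)⁻¹ *
      F (circleMap p.1 r θ, q.2))) = (d p.1 θ * (circleMap p.1 r θ - q.1)⁻¹) *
      (2 * Real.pi * I * F (circleMap p.1 r θ, q.2)) by ring, ← this,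
      ← intervalIntegral.integral_const_mul, intervalIntegral.integral_of_le Real.two_pi_pos.le]
    refine integral_congr_ae (Eventually.of_forall fun η => ?_)
    change W (θ, η) * (U₁ q.1 (θ, η) * U₂ q.2 (θ, η)) = _
    rw [he₁, he₂]
    simp only [W, BoundedContinuousFunction.coe_ofNormedAddCommGroup]
    ring
  rw [hΛ]
  field_simp

/-- Differentiation under the integral sign for holomorphic dependence on the parameter. -/
theorem differentiableOn_integral_of_dominated {F : ℂ → ℝ → ℂ} {S : Set ℂ} (hS : IsOpen S)
    {bound : ℝ → ℝ} (hb : Integrable bound) (hm : ∀ a ∈ S, AEStronglyMeasurable (F a))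
    (hd : ∀ x, DifferentiableOn ℂ (fun a => F a x) S)
    (hle : ∀ a ∈ S, ∀ x, ‖F a x‖ ≤ bound x) :
    DifferentiableOn ℂ (fun a => ∫ x, F a x) S := by
  intro a ha
  obtain ⟨r, hr, hrS⟩ := Metric.isOpen_iff.1 hS a ha
  have hat : ∀ b ∈ Metric.ball a r, ∀ x, HasDerivAt (fun b => F b x) (deriv (fun b => F b x) b) b :=
    fun b hb x => ((hd x).differentiableAt (hS.mem_nhds (hrS hb))).hasDerivAt
  have hF' : AEStronglyMeasurable (fun x => deriv (fun b => F b x) a) := by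
    -- The derivative is measurable in `x` as a pointwise limit of difference quotients; these steps
    -- stay within distance `r / 2` of `a`.
    have hseq : Tendsto (fun n : ℕ => ((r / 2 / (n + 1) : ℝ) : ℂ)) atTop (𝓝[≠] 0) := by
      refine tendsto_nhdsWithin_iff.2 ⟨?_, Eventually.of_forall fun n => ?_⟩
      · rw [← ofReal_zero]
        refine (continuous_ofReal.tendsto 0).comp ?_
        have := tendsto_one_div_add_atTop_nhds_zero_nat.const_mul (r / 2)
        simpa [div_eq_mul_inv] using this
      · rw [mem_compl_singleton_iff, ofReal_ne_zero]
        positivity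
    refine aestronglyMeasurable_of_tendsto_ae atTop
      (f := fun (n : ℕ) x => ((r / 2 / (n + 1) : ℝ) : ℂ)⁻¹ *
        (F (a + ((r / 2 / (n + 1) : ℝ) : ℂ)) x - F a x)) (fun n => ?_)
      (Eventually.of_forall fun x => ?_)
    · refine ((hm _ (hrS ?_)).sub (hm a ha)).const_mul _
      rw [Metric.mem_ball, dist_self_add_left, norm_real, Real.norm_eq_abs,
        abs_of_pos (by positivity)]
      rw [div_lt_iff₀ (by positivity)]
      have : (0 : ℝ) ≤ n := Nat.cast_nonneg n
      nlinarith
    · have := (hat a (Metric.mem_ball_self hr) x).tendsto_slope_zero.comp hseq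
      exact this
  have h := hasDerivAt_integral_of_dominated_loc_of_deriv_le (μ := volume) (F := F)
    (F' := fun b x => deriv (fun b => F b x) b) (x₀ := a) (s := Metric.ball a (r / 2))
    -- Cauchy's estimate on circles of radius `r / 2`.
    (bound := fun x => bound x / (r / 2)) (Metric.ball_mem_nhds a (by positivity))
    (by filter_upwards [hS.mem_nhds ha] with b hb using hm b hb)
    (hb.mono' (hm a ha) (Eventually.of_forall fun x => hle a ha x)) hF'
    (Eventually.of_forall fun x b hb' => ?_) (hb.div_const _)
    (Eventually.of_forall fun x b hb' => hat b (Metric.ball_subset_ball (by linarith) hb') x)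
  · exact h.2.differentiableAt.differentiableWithinAt
  · have hsub : Metric.closedBall b (r / 2) ⊆ S := fun y hy => hrS (by
      rw [Metric.mem_closedBall] at hy
      rw [Metric.mem_ball] at hb' ⊢
      linarith [dist_triangle y b a])
    refine norm_deriv_le_of_forall_mem_sphere_norm_le (by positivity)
      (DifferentiableOn.diffContOnCl ?_) fun z hz =>
        hle z (hsub (Metric.sphere_subset_closedBall hz)) x
    exact (hd x).mono ((Metric.closure_ball_subset_closedBall).trans hsub)

/-- A dominated integral depending holomorphically on two parameters is jointly analytic. -/
theorem analyticAt_integral_of_dominated {F : ℂ × ℂ → ℝ → ℂ} {p : ℂ × ℂ} {R : ℝ} (hR : 0 < R)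
    {bound : ℝ → ℝ} (hb : Integrable bound)
    (hc : ContinuousOn (fun q : (ℂ × ℂ) × ℝ => F q.1 q.2)
      ((Metric.ball p.1 R ×ˢ Metric.ball p.2 R) ×ˢ univ))
    (h₁ : ∀ x, ∀ b ∈ Metric.ball p.2 R,
      DifferentiableOn ℂ (fun a => F (a, b) x) (Metric.ball p.1 R))
    (h₂ : ∀ x, ∀ a ∈ Metric.ball p.1 R,
      DifferentiableOn ℂ (fun b => F (a, b) x) (Metric.ball p.2 R))
    (hle : ∀ q ∈ Metric.ball p.1 R ×ˢ Metric.ball p.2 R, ∀ x, ‖F q x‖ ≤ bound x) :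
    AnalyticAt ℂ (fun q => ∫ x, F q x) p := by
  have hm : ∀ q ∈ Metric.ball p.1 R ×ˢ Metric.ball p.2 R, AEStronglyMeasurable (F q) :=
    fun q hq => Continuous.aestronglyMeasurable (continuousOn_univ.1
      (hc.comp (f := fun x => (q, x)) (by fun_prop) fun x _ => ⟨hq, mem_univ _⟩))
  refine analyticAt_of_separately_differentiableOn hR ?_ (fun b hb' => ?_) fun a ha => ?_
  · refine continuousOn_of_dominated hm (fun q hq => Eventually.of_forall (hle q hq)) hb
      (Eventually.of_forall fun x => ?_)
    exact hc.comp (f := fun q => (q, x)) (by fun_prop) fun q hq => ⟨hq, mem_univ _⟩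
  · exact differentiableOn_integral_of_dominated Metric.isOpen_ball hb
      (fun a ha => hm _ ⟨ha, hb'⟩) (fun x => h₁ x b hb') fun a ha => hle _ ⟨ha, hb'⟩
  · exact differentiableOn_integral_of_dominated Metric.isOpen_ball hb
      (fun b hb' => hm _ ⟨ha, hb'⟩) (fun x => h₂ x a ha) fun b hb' => hle _ ⟨ha, hb'⟩

/-! ### Existence of admissible displacements -/

/-- `κ(k, ·)` is analytic at `z` and `1 - a / κ(k, z)` avoids the cut of `diagLog`. -/
def IsRegularAt (k : ℝ) (a z : ℂ) : Prop :=
  (0 < ((k : ℂ) - z).im ∨ ((k : ℂ) - z).re ≠ 0) ∧ (0 < ((k : ℂ) + z).im ∨ ((k : ℂ) + z).re ≠ 0) ∧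
    exp (-(I * (Real.pi / 4 : ℝ))) * (1 - a / kappa k z) ∈ slitPlane

namespace IsRegularAt

theorem analyticAt_one_sub {k : ℝ} {a z : ℂ} (h : IsRegularAt k a z) :
    AnalyticAt ℂ (fun p : ℂ × ℂ => 1 - p.1 / kappa k p.2) (a, z) :=
  analyticAt_const.sub (analyticAt_fst.div
    (AnalyticAt.fun_comp (analyticAt_kappa h.1 h.2.1) analyticAt_snd) (kappa_ne_zero h.1 h.2.1))

theorem analyticAt {k : ℝ} {a z : ℂ} (h : IsRegularAt k a z) :
    AnalyticAt ℂ (fun p : ℂ × ℂ => diagLog (1 - p.1 / kappa k p.2)) (a, z) :=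
  AnalyticAt.fun_comp (f := fun p : ℂ × ℂ => 1 - p.1 / kappa k p.2)
    (analyticAt_diagLog h.2.2) h.analyticAt_one_sub

theorem analyticAt_left {k : ℝ} {a z : ℂ} (h : IsRegularAt k a z) :
    AnalyticAt ℂ (fun a => diagLog (1 - a / kappa k z)) a :=
  AnalyticAt.fun_comp (f := fun a : ℂ => (a, z)) h.analyticAt (analyticAt_id.prod analyticAt_const)

theorem analyticAt_right {k : ℝ} {a z : ℂ} (h : IsRegularAt k a z) :
    AnalyticAt ℂ (fun z => diagLog (1 - a / kappa k z)) z :=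
  AnalyticAt.fun_comp (f := fun z : ℂ => (a, z)) h.analyticAt (analyticAt_const.prod analyticAt_id)

theorem eventually {k : ℝ} {a z : ℂ} (h : IsRegularAt k a z) :
    ∀ᶠ p : ℂ × ℂ in 𝓝 (a, z), IsRegularAt k p.1 p.2 := by
  have e1 : ∀ᶠ p : ℂ × ℂ in 𝓝 (a, z), -I * ((k : ℂ) - p.2) ∈ slitPlane :=
    ContinuousAt.eventually_mem (f := fun p : ℂ × ℂ => -I * ((k : ℂ) - p.2)) (by fun_prop)
      (isOpen_slitPlane.mem_nhds (mem_slitPlane_neg_I_mul.2 h.1))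
  have e2 : ∀ᶠ p : ℂ × ℂ in 𝓝 (a, z), -I * ((k : ℂ) + p.2) ∈ slitPlane :=
    ContinuousAt.eventually_mem (f := fun p : ℂ × ℂ => -I * ((k : ℂ) + p.2)) (by fun_prop)
      (isOpen_slitPlane.mem_nhds (mem_slitPlane_neg_I_mul.2 h.2.1))
  have e3 : ∀ᶠ p : ℂ × ℂ in 𝓝 (a, z),
      exp (-(I * (Real.pi / 4 : ℝ))) * (1 - p.1 / kappa k p.2) ∈ slitPlane :=
    ContinuousAt.eventually_mem
      (f := fun p : ℂ × ℂ => exp (-(I * (Real.pi / 4 : ℝ))) * (1 - p.1 / kappa k p.2))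
      (continuousAt_const.mul h.analyticAt_one_sub.continuousAt)
      (isOpen_slitPlane.mem_nhds h.2.2)
  filter_upwards [e1, e2, e3] with p h1 h2 h3
  exact ⟨mem_slitPlane_neg_I_mul.1 h1, mem_slitPlane_neg_I_mul.1 h2, h3⟩

end IsRegularAt

namespace IsMinusRegion

variable {k : ℝ} {A : Contour} {L : Set ℂ}

theorem isRegularAt (hA : A.IsIndented k) (hL : IsMinusRegion k A L) {a z : ℂ} (ha : a ∈ L)
    (hz : z ∈ A.carrier) : IsRegularAt k a z :=
  ⟨Contour.off_cut_sub hA (A.carrier_subset_LHP hz), Contour.off_cut_add hA (A.carrier_subset_UHP hz),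
    hL.log_off_cut a ha z hz⟩

/-- Far out, regularity follows from the decay of $\alpha_1/\kappa$. On the remaining compact piece
it is an open condition valid on the contour, so it persists for nearby $\alpha_1$ and small
displacements. -/
theorem exists_eventually_isRegularAt (hA : A.IsIndented k) (hL : IsMinusRegion k A L) {a : ℂ}
    (ha : a ∈ L) : ∃ ε₀ > 0, ∀ᶠ b in 𝓝 a, ∀ c, |c| ≤ ε₀ → ∀ x, IsRegularAt k b (A.point c x) := by
  obtain ⟨C, -, X, hX, hfar⟩ := exists_norm_diagLog_kappa_le k (‖a‖ + 1)
  -- Beyond `X` the decay estimate applies; beyond $|k|$ the vertical cuts of $\kappa(k,\cdot)$ are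
  -- out of reach.
  set Y := X + |k| + 1 with hY
  have hnear : ∀ᶠ q : ℂ × ℝ in 𝓝 (a, 0), ∀ x ∈ Icc (-Y) Y, IsRegularAt k q.1 (A.point q.2 x) := by
    refine isCompact_Icc.eventually_forall_of_forall_eventually fun x _ => ?_
    have hc : ContinuousAt (fun r : (ℂ × ℝ) × ℝ => (r.1.1, A.point r.1.2 r.2)) ((a, 0), x) := by
      refine Continuous.continuousAt ?_
      exact (continuous_fst.comp continuous_fst).prodMk
        (A.continuous_point.comp ((continuous_snd.comp continuous_fst).prodMk continuous_snd))
    exact hc.eventually (hL.isRegularAt hA ha (A.point_mem_carrier x)).eventually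
  obtain ⟨δ, hδ, h⟩ := Metric.eventually_nhds_iff.1 hnear
  refine ⟨δ / 2, by positivity, ?_⟩
  filter_upwards [Metric.ball_mem_nhds a hδ, Metric.ball_mem_nhds a one_pos] with b hb hb1 c hc x
  rcases le_or_gt |x| Y with hx | hx
  · refine h (y := (b, c)) ?_ x (abs_le.1 hx)
    rw [Prod.dist_eq, max_lt_iff]
    refine ⟨hb, ?_⟩
    rw [Real.dist_0_eq_abs]
    linarith
  · have hbR : ‖b‖ ≤ ‖a‖ + 1 := by
      rw [Metric.mem_ball, dist_eq_norm] at hb1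
      linarith [norm_sub_norm_le b a]
    have hk : |k| < |x| := by linarith
    refine ⟨Or.inr ?_, Or.inr ?_, (hfar b hbR _ (le_trans ?_ (A.abs_le_norm_point c x))).1⟩
    · rw [sub_re, ofReal_re, Contour.point_re]
      intro h0
      rw [sub_eq_zero.1 h0] at hk
      exact lt_irrefl _ hk
    · rw [add_re, ofReal_re, Contour.point_re]
      intro h0
      rw [eq_neg_of_add_eq_zero_left h0, abs_neg] at hk
      exact lt_irrefl _ hk
    · linarith [abs_nonneg k]

theorem exists_forall_isRegularAt (hA : A.IsIndented k) (hL : IsMinusRegion k A L) (R : ℝ) :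
    ∃ ε₀ > 0, ∀ a ∈ L, ‖a‖ ≤ R → ∀ c, |c| ≤ ε₀ → ∀ x, IsRegularAt k a (A.point c x) := by
  have hK : IsCompact (L ∩ Metric.closedBall 0 R) :=
    (isCompact_closedBall _ _).inter_left hL.isClosed
  have := hK.induction_on (p := fun s => ∃ ε₀ > 0, ∀ a ∈ s, ∀ c, |c| ≤ ε₀ → ∀ x,
    IsRegularAt k a (A.point c x)) ⟨1, one_pos, fun _ h => h.elim⟩
    (fun s t hst ⟨ε, hε, h⟩ => ⟨ε, hε, fun a ha => h a (hst ha)⟩)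
    (fun s t ⟨ε, hε, h⟩ ⟨ε', hε', h'⟩ => ⟨min ε ε', lt_min hε hε', fun a ha c hc x =>
      ha.elim (fun ha => h a ha c (hc.trans (min_le_left _ _)) x)
        (fun ha => h' a ha c (hc.trans (min_le_right _ _)) x)⟩)
    fun a ha => by
      obtain ⟨ε, hε, h⟩ := hL.exists_eventually_isRegularAt hA ha.1
      exact ⟨_, mem_nhdsWithin_of_mem_nhds h, ε, hε, fun b hb => hb⟩
  obtain ⟨ε, hε, h⟩ := this
  exact ⟨ε, hε, fun a ha hR => h a ⟨ha, by simpa using hR⟩⟩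

end IsMinusRegion

theorem analyticOnNhd_strip_of_isRegularAt {k ε₀ : ℝ} {A : Contour} {a : ℂ}
    (h : ∀ c, |c| ≤ ε₀ → ∀ x, IsRegularAt k a (A.point c x)) {ε : ℝ} (hε : ε ≤ ε₀) :
    AnalyticOnNhd ℂ (fun z => diagLog (1 - a / kappa k z)) (A.strip ε) := by
  intro z hz
  have := h (z.im - A.height z.re) (le_trans hz hε) z.re
  rw [← A.eq_point] at this
  exact this.analyticAt_right

/-! ### The factors and their independence of the displacement -/

namespace Contour

theorem point_mem_strip (A : Contour) {c ε : ℝ} (hc : |c| ≤ ε) (x : ℝ) :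
    A.point c x ∈ A.strip ε := by
  simpa [strip] using hc

theorem analyticAt_logKernel {A : Contour} {k : ℝ} {p : ℂ × ℂ} {ε c : ℝ}
    (hf : AnalyticOnNhd ℂ (fun z => diagLog (1 - p.1 / kappa k z)) (A.strip ε)) (hc : |c| ≤ ε)
    (hp : p.2.im - A.height p.2.re ≠ c) (x : ℝ) :
    AnalyticAt ℂ (logKernel k p) (A.point c x) := by
  refine (hf _ (A.point_mem_strip hc x)).div (analyticAt_id.sub analyticAt_const)
    (sub_ne_zero.2 fun h => hp ?_)
  rw [show p.2 = A.point c x from h.symm]; simp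

theorem tendsto_logKernel_zero (A : Contour) (k : ℝ) (p : ℂ × ℂ) {δ : ℝ} (hδ : 0 < δ) :
    ∃ X : ℝ, ∀ c x : ℝ, X ≤ |x| → ‖logKernel k p (A.point c x)‖ ≤ δ := by
  obtain ⟨C, hC, X, hX, h⟩ := A.exists_norm_logKernel_le k (max ‖p.1‖ ‖p.2‖)
  refine ⟨X + C / δ + 1, fun c x hx => (h p (le_max_left _ _) (le_max_right _ _) c x ?_).trans ?_⟩
  · have : 0 < C / δ := by positivity
    linarith
  · have h1 : C / δ ≤ |x| := by linarith
    have h2 : 1 ≤ |x| := by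
      have : 0 < C / δ := by positivity
      linarith
    rw [div_le_iff₀ hδ] at h1
    rw [← div_eq_mul_inv, div_le_iff₀ (by positivity), ← sq_abs x]
    nlinarith

/-- The integrals in the factors do not depend on the admissible displacement. -/
theorem integral_logKernel_eq {A : Contour} {k : ℝ} {p : ℂ × ℂ} {ε c₁ c₂ : ℝ}
    (hf : AnalyticOnNhd ℂ (fun z => diagLog (1 - p.1 / kappa k z)) (A.strip ε))
    (hc : c₁ ≤ c₂) (h₁ : -ε ≤ c₁) (h₂ : c₂ ≤ ε) (hp : p.2.im - A.height p.2.re ∉ Icc c₁ c₂) :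
    A.integral c₁ (logKernel k p) = A.integral c₂ (logKernel k p) := by
  have han : ∀ c ∈ Icc c₁ c₂, ∀ x, AnalyticAt ℂ (logKernel k p) (A.point c x) := fun c hc =>
    analyticAt_logKernel hf (abs_le.2 ⟨h₁.trans hc.1, hc.2.trans h₂⟩) fun h => hp (h ▸ hc)
  refine A.integral_eq_of_analyticOnNhd hc (fun z hz => ?_) (fun δ hδ => ?_)
    (A.integrableOver_logKernel k _ p fun x => (han _ ⟨le_rfl, hc⟩ x).continuousAt)
    (A.integrableOver_logKernel k _ p fun x => (han _ ⟨hc, le_rfl⟩ x).continuousAt)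
  · rw [A.eq_point z]
    exact han _ hz z.re
  · obtain ⟨X, hX⟩ := A.tendsto_logKernel_zero k p hδ
    exact ⟨X, fun c _ => hX c⟩

/-- `ε` is an admissible displacement for the parameters `p`, on the side `σ = ± 1`. -/
structure IsAdmissible (A : Contour) (k σ : ℝ) (p : ℂ × ℂ) (ε : ℝ) : Prop where
  pos : 0 < ε
  analytic : AnalyticOnNhd ℂ (fun z => diagLog (1 - p.1 / kappa k z)) (A.strip ε)
  -- The strict inequality, with margin $\varepsilon$, also admits a neighbourhood of each point of
  -- the closed region.
  side : -ε < σ * (p.2.im - A.height p.2.re)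

/-- The pole $\alpha_2$ is already on the right side of the less displaced contour, so it is not
between the two and Cauchy's theorem applies. -/
theorem IsAdmissible.integral_eq {A : Contour} {k σ : ℝ} (hσ : σ = 1 ∨ σ = -1) {p : ℂ × ℂ}
    {ε ε' : ℝ} (h : A.IsAdmissible k σ p ε) (h' : A.IsAdmissible k σ p ε') :
    A.integral (-σ * ε) (logKernel k p) = A.integral (-σ * ε') (logKernel k p) := by
  wlog hle : ε ≤ ε' generalizing ε ε'
  · exact (this h' h (le_of_not_ge hle)).symm
  have h0 := h.pos
  have h1 := h.side
  rcases hσ with rfl | rfl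
  · refine (integral_logKernel_eq h'.analytic ?_ ?_ ?_ fun hm => ?_).symm
    any_goals linarith
    linarith [hm.2]
  · refine integral_logKernel_eq h'.analytic ?_ ?_ ?_ fun hm => ?_
    any_goals linarith
    linarith [hm.1]

theorem IsAdmissible.integrableOver {A : Contour} {k σ : ℝ} (hσ : σ = 1 ∨ σ = -1) {p : ℂ × ℂ}
    {ε : ℝ} (h : A.IsAdmissible k σ p ε) : A.IntegrableOver (-σ * ε) (logKernel k p) := by
  have h0 := h.pos
  have h1 := h.side
  refine A.integrableOver_logKernel k _ p fun x =>
    (analyticAt_logKernel h.analytic ?_ ?_ x).continuousAt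
  · rcases hσ with rfl | rfl <;> simp [abs_of_pos h0]
  · intro e
    rw [e] at h1
    rcases hσ with rfl | rfl <;> linarith

/-- The explicit form of a factor, with displacement `ε`. -/
noncomputable def factorAt (A : Contour) (k σ ε : ℝ) (p : ℂ × ℂ) : ℂ :=
  1 / downSqrt (downSqrt (k + σ * p.2)) *
    exp (-σ / (4 * I * (Real.pi : ℂ)) * A.integral (-σ * ε) (logKernel k p))

open Classical in
/-- A factor of the kernel. -/
noncomputable def factor (A : Contour) (k σ : ℝ) (p : ℂ × ℂ) : ℂ :=
  -- The displacement is chosen pointwise, since one that serves all of an unbounded region of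
  -- $\alpha_1$ is not assumed. The value 0 is taken only where none is admissible.
  if h : ∃ ε, A.IsAdmissible k σ p ε then A.factorAt k σ h.choose p else 0

theorem IsAdmissible.factor_eq {A : Contour} {k σ : ℝ} (hσ : σ = 1 ∨ σ = -1) {p : ℂ × ℂ}
    {ε : ℝ} (h : A.IsAdmissible k σ p ε) : A.factor k σ p = A.factorAt k σ ε p := by
  have hex : ∃ ε, A.IsAdmissible k σ p ε := ⟨ε, h⟩
  rw [factor, dif_pos hex, factorAt, factorAt, hex.choose_spec.integral_eq hσ h]

theorem analyticAt_integral_logKernel {A : Contour} {k c R : ℝ} {p : ℂ × ℂ} (hR : 0 < R)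
    (h₁ : ∀ a ∈ Metric.closedBall p.1 R, ∀ x, IsRegularAt k a (A.point c x))
    (h₂ : ∀ b ∈ Metric.closedBall p.2 R, ∀ x, A.point c x ≠ b) :
    AnalyticAt ℂ (fun q => A.integral c (logKernel k q)) p := by
  have hc : ContinuousOn (fun q : (ℂ × ℂ) × ℝ => A.pullback c (logKernel k q.1) q.2)
      ((Metric.closedBall p.1 R ×ˢ Metric.closedBall p.2 R) ×ˢ univ) := by
    rintro ⟨⟨a, b⟩, x⟩ ⟨⟨ha, hb⟩, -⟩
    refine ContinuousAt.continuousWithinAt ?_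
    have hpt : Continuous fun q : (ℂ × ℂ) × ℝ => A.point c q.2 :=
      A.continuous_point.comp (continuous_const.prodMk continuous_snd)
    have e1 : ContinuousAt (fun q : (ℂ × ℂ) × ℝ => diagLog (1 - q.1.1 / kappa k (A.point c q.2)))
        ((a, b), x) :=
      ContinuousAt.comp (x := ((a, b), x)) (f := fun q : (ℂ × ℂ) × ℝ => (q.1.1, A.point c q.2))
        (g := fun p : ℂ × ℂ => diagLog (1 - p.1 / kappa k p.2)) (h₁ a ha x).analyticAt.continuousAt
        ((continuous_fst.comp continuous_fst).prodMk hpt).continuousAt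
    have e2 : ContinuousAt (fun q : (ℂ × ℂ) × ℝ => A.point c q.2 - q.1.2) ((a, b), x) :=
      (hpt.sub (continuous_snd.comp continuous_fst)).continuousAt
    have e3 : ContinuousAt (fun q : (ℂ × ℂ) × ℝ => 1 + ((deriv A.height q.2 : ℝ) : ℂ) * I)
        ((a, b), x) :=
      (continuous_const.add ((continuous_ofReal.comp
        (A.continuous_deriv_height.comp continuous_snd)).mul continuous_const)).continuousAt
    exact (e1.div e2 (sub_ne_zero.2 (h₂ b hb x))).mul e3
  obtain ⟨C, hC⟩ := A.exists_norm_pullback_le k c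
    ((isCompact_closedBall p.1 R).prod (isCompact_closedBall p.2 R)) hc
  have hsub : Metric.ball p.1 R ×ˢ Metric.ball p.2 R ⊆
      Metric.closedBall p.1 R ×ˢ Metric.closedBall p.2 R :=
    prod_mono Metric.ball_subset_closedBall Metric.ball_subset_closedBall
  refine analyticAt_integral_of_dominated (F := fun q x => A.pullback c (logKernel k q) x) hR
    (integrable_inv_one_add_sq.const_mul C) (hc.mono (prod_mono_left hsub)) ?_ ?_
    fun q hq x => hC q (hsub hq) x
  · intro x b hb a ha
    have e := (h₁ a (Metric.ball_subset_closedBall ha) x).analyticAt_left.differentiableAt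
    have e' := ((e.div_const (A.point c x - b)).mul_const
      (1 + ((deriv A.height x : ℝ) : ℂ) * I)).differentiableWithinAt (s := Metric.ball p.1 R)
    exact e'
  · intro x a ha b hb
    have hne := sub_ne_zero.2 (h₂ b (Metric.ball_subset_closedBall hb) x)
    have e : DifferentiableAt ℂ (fun b => diagLog (1 - a / kappa k (A.point c x)) /
        (A.point c x - b)) b := by fun_prop (disch := assumption)
    have e' := (e.mul_const
      (1 + ((deriv A.height x : ℝ) : ℂ) * I)).differentiableWithinAt (s := Metric.ball p.2 R)
    exact e'

end Contour

namespace IsMinusRegion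

variable {k : ℝ} {A : Contour} {L : Set ℂ}

/-- One displacement is admissible for all parameters near `p`, so the pointwise choice can be
replaced there by a fixed contour. -/
theorem analyticAt_factor (hA : A.IsIndented k) (hL : IsMinusRegion k A L) {σ : ℝ}
    (hσ : σ = 1 ∨ σ = -1) {p : ℂ × ℂ} (hp₁ : p.1 ∈ L)
    (hp₂ : 0 ≤ σ * (p.2.im - A.height p.2.re)) : AnalyticAt ℂ (A.factor k σ) p := by
  obtain ⟨ε, hε, hreg⟩ := hL.exists_eventually_isRegularAt hA hp₁
  have hside : ∀ᶠ b in 𝓝 p.2, -ε < σ * (b.im - A.height b.re) := by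
    have hc : Continuous fun b : ℂ => σ * (b.im - A.height b.re) := by
      have := A.continuous_height
      fun_prop
    exact (hc.tendsto p.2).eventually (lt_mem_nhds (by linarith))
  obtain ⟨r₁, hr₁, h₁⟩ := Metric.nhds_basis_closedBall.eventually_iff.1 hreg
  obtain ⟨r₂, hr₂, h₂⟩ := Metric.nhds_basis_closedBall.eventually_iff.1 hside
  have hcε : |-σ * ε| ≤ ε := by
    rcases hσ with rfl | rfl <;> simp [abs_of_pos hε]
  have hint : AnalyticAt ℂ (fun q => A.integral (-σ * ε) (Contour.logKernel k q)) p := by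
    refine Contour.analyticAt_integral_logKernel (lt_min hr₁ hr₂)
      (fun a ha x => h₁ (Metric.closedBall_subset_closedBall (min_le_left _ _) ha) _ hcε x)
      fun b hb x hx => ?_
    have := h₂ (Metric.closedBall_subset_closedBall (min_le_right _ _) hb)
    rw [← hx] at this
    simp only [Contour.point_im, Contour.point_re] at this
    rcases hσ with rfl | rfl <;> linarith
  have hoff : 0 < ((k : ℂ) + σ * p.2).im ∨ ((k : ℂ) + σ * p.2).re ≠ 0 := by
    rcases hσ with rfl | rfl
    · have := Contour.off_cut_add hA (z := p.2) (by
        change A.height p.2.re ≤ p.2.im; linarith)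
      simpa using this
    · have := Contour.off_cut_sub hA (z := p.2) (by
        change p.2.im ≤ A.height p.2.re; linarith)
      simpa [sub_eq_add_neg] using this
  have hne : downSqrt (downSqrt ((k : ℂ) + σ * p.2)) ≠ 0 := by
    rw [Ne, downSqrt_eq_zero, downSqrt_eq_zero]
    intro h
    rw [h] at hoff
    simp at hoff
  have hpre : AnalyticAt ℂ (fun q : ℂ × ℂ => downSqrt (downSqrt ((k : ℂ) + σ * q.2))) p :=
    AnalyticAt.fun_comp (f := fun q : ℂ × ℂ => (k : ℂ) + σ * q.2) (analyticAt_downSqrt_downSqrt hoff)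
      (analyticAt_const.add (analyticAt_const.mul analyticAt_snd))
  have hfac : AnalyticAt ℂ (A.factorAt k σ ε) p :=
    (analyticAt_const.div hpre hne).mul (analyticAt_const.mul hint).cexp
  refine hfac.congr ?_
  filter_upwards [(continuous_fst.tendsto p).eventually hreg,
    (continuous_snd.tendsto p).eventually hside] with q hq₁ hq₂
  exact (Contour.IsAdmissible.factor_eq hσ
    ⟨hε, analyticOnNhd_strip_of_isRegularAt hq₁ le_rfl, hq₂⟩).symm

/-- The two exponents add up to $-\frac1{4\pi i}$ times the difference of the edge integrals, which
by Cauchy's formula is $-\frac12\log(1-\alpha_1/\kappa)$; the prefactors combine by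
`downSqrt_kappa`. -/
theorem kernelMinus_eq_factor_mul (hA : A.IsIndented k) (hL : IsMinusRegion k A L) {a w : ℂ}
    (ha : a ∈ L) (hw : w ∈ A.carrier) :
    kernelMinus k a w = A.factor k 1 (a, w) * A.factor k (-1) (a, w) := by
  obtain ⟨ε, hε, hreg⟩ := hL.exists_eventually_isRegularAt hA ha
  have han := analyticOnNhd_strip_of_isRegularAt hreg.self_of_nhds le_rfl
  have hw' : w.im - A.height w.re = 0 := sub_eq_zero.2 hw
  have a1 : A.IsAdmissible k 1 (a, w) ε := ⟨hε, han, by rw [hw']; linarith⟩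
  have a2 : A.IsAdmissible k (-1) (a, w) ε := ⟨hε, han, by rw [hw']; linarith⟩
  have i1 := a1.integrableOver (Or.inl rfl)
  have i2 := a2.integrableOver (Or.inr rfl)
  rw [a1.factor_eq (Or.inl rfl), a2.factor_eq (Or.inr rfl)]
  rw [neg_one_mul] at i1
  rw [neg_neg, one_mul] at i2
  have hbdd : ∃ C X : ℝ, ∀ c x : ℝ, X ≤ |x| →
      ‖diagLog (1 - a / kappa k (A.point c x))‖ ≤ C := by
    obtain ⟨C, hC, X, hX, h⟩ := exists_norm_diagLog_kappa_le k ‖a‖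
    refine ⟨C / X, X, fun c x hx => ?_⟩
    have hx' := hx.trans (A.abs_le_norm_point c x)
    exact (h a le_rfl _ hx').2.trans (by gcongr)
  have key := A.integral_sub_integral_eq hε han hw hbdd i1 i2
  change A.integral (-ε) (Contour.logKernel k (a, w)) - A.integral ε (Contour.logKernel k (a, w)) = _
    at key
  unfold kernelMinus Contour.factorAt
  rw [hL.downSqrt_kappa_sub hA ha hw, downSqrt_kappa]
  simp only [neg_mul, one_mul, neg_neg, ofReal_one, ofReal_neg, ← sub_eq_add_neg]
  have hexp : exp (-1 / (4 * I * (Real.pi : ℂ)) * A.integral (-ε) (Contour.logKernel k (a, w))) *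
      exp (1 / (4 * I * (Real.pi : ℂ)) * A.integral ε (Contour.logKernel k (a, w))) =
      (exp (diagLog (1 - a / kappa k w) / 2))⁻¹ := by
    rw [← Complex.exp_add, ← Complex.exp_neg]
    congr 1
    have hpi : (Real.pi : ℂ) ≠ 0 := ofReal_ne_zero.2 Real.pi_ne_zero
    have hI := I_ne_zero
    rw [eq_add_of_sub_eq key]
    field_simp
    ring
  rw [mul_mul_mul_comm, hexp]
  simp only [one_div, mul_inv]
  ring

end IsMinusRegion

/-! ### Reflection to the plus half, and assembly -/

theorem kernelPlus_eq_kernelMinus_neg (k : ℝ) (a z : ℂ) :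
    kernelPlus k a z = kernelMinus k (-a) z := by
  unfold kernelPlus kernelMinus
  rw [sub_neg_eq_add]

theorem kernelK_eq_mul (k : ℝ) (a z : ℂ) :
    kernelK k a z = kernelMinus k a z * kernelPlus k a z := by
  unfold kernelK kernelMinus kernelPlus kappa
  rw [div_mul_div_comm, one_mul]

theorem one_add_div_eq (k : ℝ) (a z : ℂ) :
    1 + a / kappa k z = 1 - -a / kappa k z := by ring

/-- Replacing $\alpha_1$ by $-\alpha_1$ turns the region above $\mathcal A_1$ into the region below
the rotated contour, which satisfies the same hypotheses. -/
theorem isMinusRegion_neg_UHP {k : ℝ} {A₁ A₂ : Contour}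
    (hA₁ : A₁.IsIndented k) (hA₂ : A₂.IsIndented k)
    (hcut : ∀ α₁ ∈ A₁.carrier, ∀ α₂ ∈ A₂.carrier, 1 + α₁ / kappa k α₂ ∉ diagLogCut) :
    IsMinusRegion k A₂ A₁.neg.LHP := by
  refine isMinusRegion_LHP hA₁.neg hA₂ fun a ha z hz => ?_
  have := hcut (-a) (Contour.mem_neg_carrier.1 ha) z hz
  rwa [one_add_div_eq, neg_neg] at this

namespace Contour

theorem factor_one_formula {A : Contour} {k ε : ℝ} {a w : ℂ} (hε : 0 < ε)
    (hf : AnalyticOnNhd ℂ (fun z => diagLog (1 - a / kappa k z)) (A.strip ε)) (hw : w ∈ A.UHP) :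
    A.IntegrableOver (-ε) (fun z => diagLog (1 - a / kappa k z) / (z - w)) ∧
      A.factor k 1 (a, w) = 1 / downSqrt (downSqrt (k + w)) *
        exp (-1 / (4 * I * (Real.pi : ℂ)) *
          A.integral (-ε) (fun z => diagLog (1 - a / kappa k z) / (z - w))) := by
  have hw' : A.height w.re ≤ w.im := hw
  have h : A.IsAdmissible k 1 (a, w) ε := ⟨hε, hf, by simp only [one_mul]; linarith⟩
  have hi := h.integrableOver (Or.inl rfl)
  rw [neg_one_mul] at hi
  refine ⟨hi, ?_⟩
  rw [h.factor_eq (Or.inl rfl), factorAt, neg_one_mul, ofReal_one, one_mul]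
  rfl

theorem factor_neg_one_formula {A : Contour} {k ε : ℝ} {a w : ℂ} (hε : 0 < ε)
    (hf : AnalyticOnNhd ℂ (fun z => diagLog (1 - a / kappa k z)) (A.strip ε)) (hw : w ∈ A.LHP) :
    A.IntegrableOver ε (fun z => diagLog (1 - a / kappa k z) / (z - w)) ∧
      A.factor k (-1) (a, w) = 1 / downSqrt (downSqrt (k - w)) *
        exp (1 / (4 * I * (Real.pi : ℂ)) *
          A.integral ε (fun z => diagLog (1 - a / kappa k z) / (z - w))) := by
  have hw' : w.im ≤ A.height w.re := hw
  have h : A.IsAdmissible k (-1) (a, w) ε := ⟨hε, hf, by simp only [neg_one_mul]; linarith⟩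
  have hi := h.integrableOver (Or.inr rfl)
  rw [neg_neg, one_mul] at hi
  refine ⟨hi, ?_⟩
  rw [h.factor_eq (Or.inr rfl), factorAt, neg_neg, one_mul, ofReal_neg, ofReal_one, neg_one_mul,
    neg_neg, ← sub_eq_add_neg]
  rfl

end Contour

end

theorem mainTheorem2 (k : ℝ) (hk : 0 < k) (A₁ A₂ : Contour)
    (hA₁ : A₁.IsIndented k) (hA₂ : A₂.IsIndented k)
    (hcut : ∀ α₁ ∈ A₁.carrier, ∀ α₂ ∈ A₂.carrier,
      1 - α₁ / kappa k α₂ ∉ diagLogCut ∧ 1 + α₁ / kappa k α₂ ∉ diagLogCut) :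
    -- first split, in the `α₁`-plane
    (∀ α₁ ∈ A₁.carrier, ∀ α₂ ∈ A₂.carrier,
      kernelK k α₁ α₂ = kernelMinus k α₁ α₂ * kernelPlus k α₁ α₂) ∧
    (∀ α₂ ∈ A₂.carrier,
      AnalyticOnNhd ℂ (fun α₁ => kernelMinus k α₁ α₂) A₁.LHP ∧
      AnalyticOnNhd ℂ (fun α₁ => kernelPlus k α₁ α₂) A₁.UHP) ∧
    -- admissible displacements `ε` exist, uniformly for bounded `α₁`
    (∀ R : ℝ, ∃ ε₀ > 0, ∀ ε : ℝ, 0 < ε → ε ≤ ε₀ →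
      (∀ α₁ ∈ A₁.LHP, ‖α₁‖ ≤ R →
        AnalyticOnNhd ℂ (fun z => diagLog (1 - α₁ / kappa k z)) (A₂.strip ε)) ∧
      (∀ α₁ ∈ A₁.UHP, ‖α₁‖ ≤ R →
        AnalyticOnNhd ℂ (fun z => diagLog (1 + α₁ / kappa k z)) (A₂.strip ε))) ∧
    -- the four factors
    ∃ Kpp Kpm Kmp Kmm : ℂ × ℂ → ℂ,
      AnalyticOnNhd ℂ Kpp (A₁.UHP ×ˢ A₂.UHP) ∧
      AnalyticOnNhd ℂ Kpm (A₁.UHP ×ˢ A₂.LHP) ∧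
      AnalyticOnNhd ℂ Kmp (A₁.LHP ×ˢ A₂.UHP) ∧
      AnalyticOnNhd ℂ Kmm (A₁.LHP ×ˢ A₂.LHP) ∧
      (∀ α₁ ∈ A₁.carrier, ∀ α₂ ∈ A₂.carrier,
        kernelK k α₁ α₂ = Kpp (α₁, α₂) * Kpm (α₁, α₂) * Kmp (α₁, α₂) * Kmm (α₁, α₂)) ∧
      (∀ α₁ ∈ A₁.LHP, ∀ α₂ ∈ A₂.carrier,
        kernelMinus k α₁ α₂ = Kmp (α₁, α₂) * Kmm (α₁, α₂)) ∧
      (∀ α₁ ∈ A₁.UHP, ∀ α₂ ∈ A₂.carrier,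
        kernelPlus k α₁ α₂ = Kpp (α₁, α₂) * Kpm (α₁, α₂)) ∧
      -- the integral formulae, for every admissible `ε`
      (∀ α₁ ∈ A₁.LHP, ∀ ε : ℝ, 0 < ε →
        AnalyticOnNhd ℂ (fun z => diagLog (1 - α₁ / kappa k z)) (A₂.strip ε) →
        (∀ α₂ ∈ A₂.UHP,
          A₂.IntegrableOver (-ε) (fun z => diagLog (1 - α₁ / kappa k z) / (z - α₂)) ∧
          Kmp (α₁, α₂) = 1 / downSqrt (downSqrt (k + α₂)) *
            Complex.exp (-1 / (4 * Complex.I * (Real.pi : ℂ)) *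
              A₂.integral (-ε) (fun z => diagLog (1 - α₁ / kappa k z) / (z - α₂)))) ∧
        (∀ α₂ ∈ A₂.LHP,
          A₂.IntegrableOver ε (fun z => diagLog (1 - α₁ / kappa k z) / (z - α₂)) ∧
          Kmm (α₁, α₂) = 1 / downSqrt (downSqrt (k - α₂)) *
            Complex.exp (1 / (4 * Complex.I * (Real.pi : ℂ)) *
              A₂.integral ε (fun z => diagLog (1 - α₁ / kappa k z) / (z - α₂))))) ∧
      (∀ α₁ ∈ A₁.UHP, ∀ ε : ℝ, 0 < ε →
        AnalyticOnNhd ℂ (fun z => diagLog (1 + α₁ / kappa k z)) (A₂.strip ε) →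
        (∀ α₂ ∈ A₂.UHP,
          A₂.IntegrableOver (-ε) (fun z => diagLog (1 + α₁ / kappa k z) / (z - α₂)) ∧
          Kpp (α₁, α₂) = 1 / downSqrt (downSqrt (k + α₂)) *
            Complex.exp (-1 / (4 * Complex.I * (Real.pi : ℂ)) *
              A₂.integral (-ε) (fun z => diagLog (1 + α₁ / kappa k z) / (z - α₂)))) ∧
        (∀ α₂ ∈ A₂.LHP,
          A₂.IntegrableOver ε (fun z => diagLog (1 + α₁ / kappa k z) / (z - α₂)) ∧
          Kpm (α₁, α₂) = 1 / downSqrt (downSqrt (k - α₂)) *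
            Complex.exp (1 / (4 * Complex.I * (Real.pi : ℂ)) *
              A₂.integral ε (fun z => diagLog (1 + α₁ / kappa k z) / (z - α₂))))) := by
  have hL := isMinusRegion_LHP hA₁ hA₂ fun a ha z hz => (hcut a ha z hz).1
  have hU := isMinusRegion_neg_UHP hA₁ hA₂ fun a ha z hz => (hcut a ha z hz).2
  have hneg : ∀ a ∈ A₁.UHP, -a ∈ A₁.neg.LHP := fun a ha =>
    Contour.mem_neg_LHP.2 (by rwa [neg_neg])
  have hneg_an : ∀ p : ℂ × ℂ, AnalyticAt ℂ (fun q : ℂ × ℂ => (-q.1, q.2)) p := fun p =>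
    analyticAt_fst.neg.prod analyticAt_snd
  have hminus : ∀ α₁ ∈ A₁.LHP, ∀ α₂ ∈ A₂.carrier, kernelMinus k α₁ α₂ =
      A₂.factor k 1 (α₁, α₂) * A₂.factor k (-1) (α₁, α₂) := fun a ha z hz =>
    hL.kernelMinus_eq_factor_mul hA₂ ha hz
  -- The plus factors are the same two functions evaluated at $-\alpha_1$.
  have hplus : ∀ α₁ ∈ A₁.UHP, ∀ α₂ ∈ A₂.carrier, kernelPlus k α₁ α₂ =
      A₂.factor k 1 (-α₁, α₂) * A₂.factor k (-1) (-α₁, α₂) := fun a ha z hz => by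
    rw [kernelPlus_eq_kernelMinus_neg]
    exact hU.kernelMinus_eq_factor_mul hA₂ (hneg a ha) hz
  refine ⟨fun a _ z _ => kernelK_eq_mul k a z, fun z hz =>
    ⟨fun a ha => hL.analyticAt_kernelMinus ha hz, fun a ha => ?_⟩, fun R => ?_,
    fun q => A₂.factor k 1 (-q.1, q.2), fun q => A₂.factor k (-1) (-q.1, q.2),
    A₂.factor k 1, A₂.factor k (-1), fun p hp => ?_, fun p hp => ?_, fun p hp => ?_,
    fun p hp => ?_, fun a ha z hz => ?_, hminus, hplus, fun a _ ε hε hf =>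
      ⟨fun w hw => Contour.factor_one_formula hε hf hw,
        fun w hw => Contour.factor_neg_one_formula hε hf hw⟩, fun a _ ε hε hf => ?_⟩
  · simp only [kernelPlus_eq_kernelMinus_neg]
    exact AnalyticAt.fun_comp (f := fun a : ℂ => -a)
      (hU.analyticAt_kernelMinus (hneg a ha) hz) analyticAt_id.neg
  · obtain ⟨ε₁, hε₁, h₁⟩ := hL.exists_forall_isRegularAt hA₂ R
    obtain ⟨ε₂, hε₂, h₂⟩ := hU.exists_forall_isRegularAt hA₂ R
    refine ⟨min ε₁ ε₂, lt_min hε₁ hε₂, fun ε _ hε => ⟨fun a ha hR => ?_, fun a ha hR => ?_⟩⟩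
    · exact analyticOnNhd_strip_of_isRegularAt (h₁ a ha hR) (hε.trans (min_le_left _ _))
    · simp only [one_add_div_eq]
      exact analyticOnNhd_strip_of_isRegularAt (h₂ (-a) (hneg a ha) (by rwa [norm_neg]))
        (hε.trans (min_le_right _ _))
  · exact AnalyticAt.fun_comp (f := fun q : ℂ × ℂ => (-q.1, q.2))
      (hU.analyticAt_factor hA₂ (Or.inl rfl) (p := (-p.1, p.2)) (hneg _ hp.1)
        (by have : A₂.height p.2.re ≤ p.2.im := hp.2
            linarith)) (hneg_an p)
  · exact AnalyticAt.fun_comp (f := fun q : ℂ × ℂ => (-q.1, q.2))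
      (hU.analyticAt_factor hA₂ (Or.inr rfl) (p := (-p.1, p.2)) (hneg _ hp.1)
        (by have : p.2.im ≤ A₂.height p.2.re := hp.2
            linarith)) (hneg_an p)
  · exact hL.analyticAt_factor hA₂ (Or.inl rfl) hp.1
      (by have : A₂.height p.2.re ≤ p.2.im := hp.2
          linarith)
  · exact hL.analyticAt_factor hA₂ (Or.inr rfl) hp.1
      (by have : p.2.im ≤ A₂.height p.2.re := hp.2
          linarith)
  · rw [kernelK_eq_mul, hminus a (A₁.carrier_subset_LHP ha) z hz,
      hplus a (A₁.carrier_subset_UHP ha) z hz]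
    ring
  · simp only [one_add_div_eq] at hf ⊢
    exact ⟨fun w hw => Contour.factor_one_formula hε hf hw,
      fun w hw => Contour.factor_neg_one_formula hε hf hw⟩
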